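/- Let $p\ge q\ge 0$ be integers, $F$ a constant real $p\times q$ matrix and $c\in\mathbb C$. On $T^*SO(p)=\{(k,\ell):k\in SO(p),\ \ell\in so(p)\}$ take the Lie--Poisson brackets $$\{\ell_{ij},\ell_{mn}\}=\delta_{in}\ell_{jm}+\delta_{jm}\ell_{in}-\delta_{im}\ell_{jn}-\delta_{jn}\ell_{im},\qquad \{\ell_{ij},k_{nm}\}=\delta_{jm}k_{ni}-\delta_{im}k_{nj},\qquad \{k_{ij},k_{mn}\}=0,$$ extended $\mathbb C$-bilinearly to complex-valued functions. Let $E$ be the $p\times q$ matrix $E_{ij}=\delta_{ij}$ and put, in $(p,q)$-block form, $$L(\lambda)=\lambda\,\mathbf a+\mathbf l+\lambda^{-1}\mathbf s,\quad \mathbf a=\begin{pmatrix}0&kEr^T\\ rE^Tk^T&0\end{pmatrix},\quad \mathbf l=-\begin{pmatrix}k\ell k^T&0\\0&r\,m\,r^T\end{pmatrix},\quad \mathbf s=\begin{pmatrix}0&F\\F^T&0\end{pmatrix},$$ $$L_y(\lambda)=(1-\lambda^{-1}y)^{-1}\bigl(\lambda\,\mathbf a+\mathbf l-\tfrac12(y\mathbf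 a+\mathbf a y)+\lambda^{-1}\mathbf s\bigr),\qquad y=c\begin{pmatrix}0&F\\-F^T&0\end{pmatrix},$$ where $r\in SO(q)$, $m\in so(q)$. Impose the constraints $m+P\ell P=0$, $r=1$, where $P=EE^T$ is the orthogonal projection of $\mathbb R^p$ onto the span of its first $q$ basis vectors; that is, $m=-E^T\ell E$ and $r=1$. Then $L(\lambda)$ becomes the rest-frame Lax matrix of the generalized $p$-dimensional Kowalevski top, $$L^{Kow}(\lambda)=\lambda\begin{pmatrix}0&kE\\E^Tk^T&0\end{pmatrix}-\begin{pmatrix}k\ell k^T&0\\0&-E^T\ell E\end{pmatrix}+\lambda^{-1}\begin{pmatrix}0&F\\F^T&0\end{pmatrix},$$ and $L_y(\lambda)$ becomes a matrix function on $T^*SO(p)$, again denoted $L_y(\lambda)$. Let $$r_{12}(\lambda,\mu)=-\frac{\lambda^2}{\lambda^2-\mu^2}\sum_\alpha Z_\alpha\otimes Z_\alpha+\frac{\lambda\mu}{\lambda^2-\mu^2}\sum_\beta S_\beta\otimes S_\beta,$$ where $Z_\alpha$ runs over the matrices $E_{ij}-E_{ji}$, $i<j$, of $so(p)$ (upper left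 block) and of $so(q)$ (lower right block), and $S_\beta$ runs over the $pq$ symmetric matrices with off-diagonal blocks $E_{ij}$ and $E_{ji}$ (here $E_{ij}$ are matrix units), and let $$r^{y}_{12}(\lambda,\mu)=\bigl[1\otimes(1-\mu^{-1}y)^{-1}\bigr]\,r_{12}(\lambda,\mu)\,\bigl[(1-\lambda^{-1}y)\otimes1\bigr].$$ Then, for $(\mathcal L,\rho_{12})=(L^{Kow},r_{12})$ and for $(\mathcal L,\rho_{12})=(L_y,r^y_{12})$, and for all $\lambda,\mu\in\mathbb C\setminus\{0\}$ (such that $1-\lambda^{-1}y$ and $1-\mu^{-1}y$ are invertible, in the case of $L_y$): 1. the spectral invariants are in involution: $\{\operatorname{tr}\mathcal L(\lambda)^i,\operatorname{tr}\mathcal L(\mu)^j\}=0$ for all $i,j\ge0$, and any coefficient of the characteristic polynomial of $\mathcal L(\lambda)$ Poisson commutes with any coefficient of that of $\mathcal L(\mu)$; 2. if $\lambda^2\ne\mu^2$, the $r$-matrix relation $$-\{\mathcal L(\lambda)\otimes1,\,1\otimes\mathcal L(\mu)\}=[\rho_{12}(\lambda,\mu),\mathcal L(\lambda)\otimes1]-[\rho_{21}(\lambda,\mu),1\otimes\mathcal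 L(\mu)]$$ holds, where $\rho_{21}(\lambda,\mu)=\Pi\,\rho_{12}(\mu,\lambda)\,\Pi$, $\Pi$ is the permutation operator, $\Pi(X\otimes Y)=(Y\otimes X)\Pi$, and the entries of $\{\mathcal L(\lambda)\otimes1,1\otimes\mathcal L(\mu)\}$ are the brackets $\{\mathcal L_{ij}(\lambda),\mathcal L_{mn}(\mu)\}$ in row $(i,m)$ and column $(j,n)$. -/

import Mathlib

open scoped Kronecker

noncomputable section

namespace KowalevskiTop

/-! ### The phase space `T^*SO(p)` and its Poisson brackets -/

/-- The phase space `T^*SO(p)`, in the left trivialisation `SO(p) × so(p)`: a point is `(k, ℓ)`. -/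
abbrev CotSO (p : ℕ) : Type :=
  Matrix.specialOrthogonalGroup (Fin p) ℝ × LieAlgebra.Orthogonal.so (Fin p) ℝ

/-- The configuration matrix `k` of a point of `T^*SO(p)`. -/
def CotSO.k {p : ℕ} (x : CotSO p) : Matrix (Fin p) (Fin p) ℝ := x.1.1

/-- The momentum matrix `ℓ` of a point of `T^*SO(p)`. -/
def CotSO.l {p : ℕ} (x : CotSO p) : Matrix (Fin p) (Fin p) ℝ := x.2.1

/-- The element `E_{ij} - E_{ji}` of `so(p)`. -/
def gen {p : ℕ} (i j : Fin p) : LieAlgebra.Orthogonal.so (Fin p) ℝ :=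
  ⟨Matrix.single i j 1 - Matrix.single j i 1, by
    rw [LieAlgebra.Orthogonal.mem_so]
    simp [Matrix.transpose_sub]⟩

theorem exp_mem_orthogonalGroup {p : ℕ} {X : Matrix (Fin p) (Fin p) ℝ} (hX : X.transpose = -X) :
    NormedSpace.exp X ∈ Matrix.orthogonalGroup (Fin p) ℝ := by
  rw [Matrix.mem_orthogonalGroup_iff]
  have h : star (NormedSpace.exp X) = NormedSpace.exp (-X) := by
    rw [Matrix.star_eq_conjTranspose, Matrix.conjTranspose_eq_transpose_of_trivial,
      ← Matrix.exp_transpose, hX]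
  change NormedSpace.exp X * star (NormedSpace.exp X) = 1
  rw [h, ← Matrix.exp_add_of_commute _ _ (Commute.neg_right (Commute.refl X)), add_neg_cancel,
    NormedSpace.exp_zero]

/-- The exponential map `so(p) → SO(p)`. -/
def expSO {p : ℕ} (X : LieAlgebra.Orthogonal.so (Fin p) ℝ) :
    Matrix.specialOrthogonalGroup (Fin p) ℝ :=
  ⟨NormedSpace.exp X.1, by
    have hX := (LieAlgebra.Orthogonal.mem_so _ _ X.1).1 X.2
    refine Matrix.mem_specialOrthogonalGroup_iff.2 ⟨exp_mem_orthogonalGroup hX, ?_⟩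
    have hY : ((1 / 2 : ℝ) • X.1).transpose = -((1 / 2 : ℝ) • X.1) := by
      rw [Matrix.transpose_smul, hX, smul_neg]
    have h1 := congrArg Matrix.det ((Matrix.mem_orthogonalGroup_iff _ _).1
      (exp_mem_orthogonalGroup hY))
    have h2 : X.1 = (1 / 2 : ℝ) • X.1 + (1 / 2 : ℝ) • X.1 := by
      rw [← add_smul]; norm_num
    rw [h2, Matrix.exp_add_of_commute _ _ (Commute.refl _), Matrix.det_mul]
    rwa [Matrix.det_mul, Matrix.det_transpose, Matrix.det_one] at h1⟩

/-- The derivative of `f` along the left-invariant vector field `k ↦ k X` on `SO(p)`. -/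
def leftDeriv {p : ℕ} (X : LieAlgebra.Orthogonal.so (Fin p) ℝ) (f : CotSO p → ℂ)
    (x : CotSO p) : ℂ :=
  deriv (fun t : ℝ => f (x.1 * expSO (t • X), x.2)) 0

/-- The derivative of `f` in the direction `Y` of the fibre `so(p)`; for `Y = gen i j` it is the
partial derivative in the independent coordinate `ℓ_{ij} = -ℓ_{ji}`. -/
def fibreDeriv {p : ℕ} (Y : LieAlgebra.Orthogonal.so (Fin p) ℝ) (f : CotSO p → ℂ)
    (x : CotSO p) : ℂ :=
  deriv (fun t : ℝ => f (x.1, x.2 + t • Y)) 0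

/-- The structure functions
`{ℓ_{ij}, ℓ_{mn}} = δ_{in} ℓ_{jm} + δ_{jm} ℓ_{in} - δ_{im} ℓ_{jn} - δ_{jn} ℓ_{im}`. -/
def structFun {p : ℕ} (x : CotSO p) (i j m n : Fin p) : ℝ :=
  (if i = n then x.l j m else 0) + (if j = m then x.l i n else 0)
    - (if i = m then x.l j n else 0) - (if j = n then x.l i m else 0)

/-- The canonical Lie-Poisson bracket on `T^*SO(p)` (extended `ℂ`-bilinearly to complex-valued
functions), in which
`{ℓ_{ij}, ℓ_{mn}} = structFun i j m n`, `{ℓ_{ij}, k_{nm}} = δ_{jm} k_{ni} - δ_{im} k_{nj}` and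
`{k_{ij}, k_{mn}} = 0`; these three are the lemmas `bracket_l_l`, `bracket_l_k`, `bracket_k_k`.
The derivation `{ℓ_{ij}, ·}` acts on functions of `k` as the left-invariant field of `gen i j`. -/
def bracket {p : ℕ} (f g : CotSO p → ℂ) (x : CotSO p) : ℂ :=
  (∑ i, ∑ j ∈ Finset.Ioi i,
      (fibreDeriv (gen i j) f x * leftDeriv (gen i j) g x
        - leftDeriv (gen i j) f x * fibreDeriv (gen i j) g x))
    + ∑ i, ∑ j ∈ Finset.Ioi i, ∑ m, ∑ n ∈ Finset.Ioi m,
        fibreDeriv (gen i j) f x * fibreDeriv (gen m n) g x * (structFun x i j m n : ℂ)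

theorem hasDerivAt_mul_exp_apply {p : ℕ} (K X : Matrix (Fin p) (Fin p) ℝ) (a b : Fin p) :
    HasDerivAt (fun t : ℝ => (K * NormedSpace.exp (t • X)) a b) ((K * X) a b) 0 := by
  open scoped Matrix.Norms.Operator in
  have h := (hasDerivAt_exp_smul_const (𝕂 := ℝ) X (0 : ℝ)).const_mul K
  simp only [zero_smul, NormedSpace.exp_zero, one_mul] at h
  exact (hasDerivAt_pi.1 ((hasDerivAt_pi.1 h) a)) b

theorem gen_apply {p : ℕ} (i j a b : Fin p) :
    (gen i j).1 a b = (if i = a ∧ j = b then 1 else 0) - (if j = a ∧ i = b then 1 else 0) := by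
  simp [gen, Matrix.single_apply]

theorem fibreDeriv_l {p : ℕ} (Y : LieAlgebra.Orthogonal.so (Fin p) ℝ) (a b : Fin p)
    (x : CotSO p) : fibreDeriv Y (fun z => (z.l a b : ℂ)) x = (Y.1 a b : ℂ) := by
  have h : HasDerivAt (fun t : ℝ => x.2.1 a b + t * Y.1 a b) (Y.1 a b) 0 := by
    simpa using ((hasDerivAt_id (0 : ℝ)).mul_const (Y.1 a b)).const_add (x.2.1 a b)
  exact h.ofReal_comp.deriv

theorem leftDeriv_k {p : ℕ} (Y : LieAlgebra.Orthogonal.so (Fin p) ℝ) (a b : Fin p)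
    (x : CotSO p) : leftDeriv Y (fun z => (z.k a b : ℂ)) x = ((x.k * Y.1) a b : ℂ) :=
  (hasDerivAt_mul_exp_apply x.k Y.1 a b).ofReal_comp.deriv

theorem fibreDeriv_k {p : ℕ} (Y : LieAlgebra.Orthogonal.so (Fin p) ℝ) (a b : Fin p)
    (x : CotSO p) : fibreDeriv Y (fun z => (z.k a b : ℂ)) x = 0 := by
  simp [fibreDeriv, CotSO.k]

theorem leftDeriv_l {p : ℕ} (Y : LieAlgebra.Orthogonal.so (Fin p) ℝ) (a b : Fin p)
    (x : CotSO p) : leftDeriv Y (fun z => (z.l a b : ℂ)) x = 0 := by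
  simp [leftDeriv, CotSO.l]

theorem sum_gen {p : ℕ} (a b : Fin p) (G : Fin p → Fin p → ℂ) (hG : ∀ i j, G j i = -G i j) :
    ∑ i, ∑ j ∈ Finset.Ioi i, ((gen i j).1 a b : ℂ) * G i j = G a b := by
  have h0 : ∀ i, G i i = 0 := fun i => self_eq_neg.1 (hG i i)
  have h1 : ∀ i j : Fin p, ((gen i j).1 a b : ℂ) * G i j =
      (if i = a ∧ j = b then G a b else 0) + (if j = a ∧ i = b then G a b else 0) := by
    intro i j
    rw [gen_apply]
    have := hG i j
    split_ifs <;> simp only [Complex.ofReal_sub, Complex.ofReal_one, Complex.ofReal_zero] <;> grind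
  have h2 : ∀ c d : Fin p, (∑ i, ∑ j ∈ Finset.Ioi i, if i = c ∧ j = d then G a b else 0) =
      if c < d then G a b else 0 := by
    intro c d
    rw [Finset.sum_eq_single c (fun i _ hi => by simp [hi]) (by simp)]
    simp
  have h3 : ∀ c d : Fin p, (∑ i, ∑ j ∈ Finset.Ioi i, if j = d ∧ i = c then G a b else 0) =
      if c < d then G a b else 0 := by
    intro c d
    simpa only [and_comm] using h2 c d
  simp only [h1, Finset.sum_add_distrib, h2, h3]
  rcases lt_trichotomy a b with h | h | h
  · simp [h, h.not_gt]
  · subst h; simp [h0]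
  · simp [h, h.not_gt]

theorem bracket_k_k {p : ℕ} (i j m n : Fin p) (x : CotSO p) :
    bracket (fun z => (z.k i j : ℂ)) (fun z => (z.k m n : ℂ)) x = 0 := by
  simp [bracket, fibreDeriv_k]

theorem bracket_l_k {p : ℕ} (i j n m : Fin p) (x : CotSO p) :
    bracket (fun z => (z.l i j : ℂ)) (fun z => (z.k n m : ℂ)) x =
      (((if j = m then x.k n i else 0) - (if i = m then x.k n j else 0) : ℝ) : ℂ) := by
  simp only [bracket, fibreDeriv_k, fibreDeriv_l, leftDeriv_k, leftDeriv_l, mul_zero, zero_mul,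
    sub_zero, Finset.sum_const_zero, add_zero]
  rw [sum_gen i j (fun a b => ((x.k * (gen a b).1) n m : ℂ))]
  · congr 1
    simp [Matrix.mul_apply, gen_apply, mul_sub, Finset.sum_sub_distrib, ite_and]
  · intro a b
    have : (gen b a).1 = -(gen a b).1 := by simp [gen]
    rw [this]
    simp

theorem bracket_l_l {p : ℕ} (i j m n : Fin p) (x : CotSO p) :
    bracket (fun z => (z.l i j : ℂ)) (fun z => (z.l m n : ℂ)) x =
      (structFun x i j m n : ℂ) := by
  have hl : ∀ a b, x.l b a = -x.l a b := fun a b =>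
    congrFun (congrFun ((LieAlgebra.Orthogonal.mem_so _ _ x.2.1).1 x.2.2) a) b
  simp only [bracket, fibreDeriv_l, leftDeriv_l, mul_zero, zero_mul,
    sub_zero, Finset.sum_const_zero, zero_add, mul_assoc, ← Finset.mul_sum]
  have h2 : ∀ a b, ∑ c, ∑ d ∈ Finset.Ioi c, ((gen c d).1 m n : ℂ) * (structFun x a b c d : ℂ)
      = (structFun x a b m n : ℂ) := by
    intro a b
    refine sum_gen m n (fun c d => (structFun x a b c d : ℂ)) ?_
    intro c d
    simp only [structFun]
    push_cast
    split_ifs <;> simp <;> ring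
  simp only [h2]
  refine sum_gen i j (fun a b => (structFun x a b m n : ℂ)) ?_
  intro a b
  simp only [structFun]
  rw [← Complex.ofReal_neg]
  congr 1
  split_ifs <;> grind

/-! ### Lax matrices -/

/-- Index type of `(p, q)`-block matrices. -/
abbrev Blk (p q : ℕ) : Type := Fin p ⊕ Fin q

/-- A real matrix regarded as a complex one. -/
def toC {m n : Type} (M : Matrix m n ℝ) : Matrix m n ℂ := M.map (fun t => (t : ℂ))

/-- The truncated identity matrix `E_{ij} = δ_{ij}` of size `p × q`. -/
def truncId (p q : ℕ) : Matrix (Fin p) (Fin q) ℝ :=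
  Matrix.of fun i j => if i.val = j.val then 1 else 0

/-- The matrix `a` with off-diagonal blocks `k A rᵀ` and `r Aᵀ kᵀ`. -/
def laxA {p q : ℕ} (A : Matrix (Fin p) (Fin q) ℝ) (x : CotSO p) (z : CotSO q) :
    Matrix (Blk p q) (Blk p q) ℂ :=
  toC (Matrix.fromBlocks 0 (x.k * A * z.k.transpose) (z.k * A.transpose * x.k.transpose) 0)

/-- The matrix `l = -diag (k ℓ kᵀ, r m rᵀ)`. -/
def laxL {p q : ℕ} (x : CotSO p) (z : CotSO q) : Matrix (Blk p q) (Blk p q) ℂ :=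
  -toC (Matrix.fromBlocks (x.k * x.l * x.k.transpose) 0 0 (z.k * z.l * z.k.transpose))

/-- The constant matrix `s` with off-diagonal blocks `F` and `Fᵀ`. -/
def laxS {p q : ℕ} (F : Matrix (Fin p) (Fin q) ℝ) : Matrix (Blk p q) (Blk p q) ℂ :=
  toC (Matrix.fromBlocks 0 F F.transpose 0)

/-- The constant matrix `y` with off-diagonal blocks `c F` and `-c Fᵀ`. -/
def yMat {p q : ℕ} (F : Matrix (Fin p) (Fin q) ℝ) (c : ℂ) : Matrix (Blk p q) (Blk p q) ℂ :=
  c • toC (Matrix.fromBlocks 0 F (-F.transpose) 0)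

/-- The rest-frame Lax matrix `L(λ) = λ a + l + λ⁻¹ s` on `T^*SO(p) × T^*SO(q)`, at the point
`x = (k, ℓ)`, `z = (r, m)`. -/
def lax {p q : ℕ} (A F : Matrix (Fin p) (Fin q) ℝ) (x : CotSO p) (z : CotSO q) (lam : ℂ) :
    Matrix (Blk p q) (Blk p q) ℂ :=
  lam • laxA A x z + laxL x z + lam⁻¹ • laxS F

/-- The deformed Lax matrix
`L_y(λ) = (1 - λ⁻¹ y)⁻¹ (λ a + l - (y a + a y) / 2 + λ⁻¹ s)` on `T^*SO(p) × T^*SO(q)`. -/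
def laxY {p q : ℕ} (A F : Matrix (Fin p) (Fin q) ℝ) (c : ℂ) (x : CotSO p) (z : CotSO q)
    (lam : ℂ) : Matrix (Blk p q) (Blk p q) ℂ :=
  (1 - lam⁻¹ • yMat F c)⁻¹ *
    (lam • laxA A x z
      + (laxL x z - (1 / 2 : ℂ) • (yMat F c * laxA A x z + laxA A x z * yMat F c))
      + lam⁻¹ • laxS F)

/-! ### The reduction `m + PℓP = 0`, `r = 1` -/

/-- The constraints `m + PℓP = 0`, `r = 1` on a point `((k, ℓ), (r, m))`. Here `P = E Eᵀ` is the
orthogonal projection of `ℝ^p` onto the span of the first `q` basis vectors, and `m`, acting on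
`ℝ^q`, is regarded as the operator `E m Eᵀ` on that span. -/
def KowConstraint {p q : ℕ} (x : CotSO p) (z : CotSO q) : Prop :=
  truncId p q * z.l * (truncId p q).transpose
      + (truncId p q * (truncId p q).transpose) * x.l * (truncId p q * (truncId p q).transpose) = 0
    ∧ z.k = 1

/-- The solution `(r, m) = (1, -Eᵀ ℓ E)` of the constraints over the point `x = (k, ℓ)`; the
points `(x, kowPoint q x)` form the reduced phase space `T^*SO(p)`. -/
def kowPoint {p : ℕ} (q : ℕ) (x : CotSO p) : CotSO q :=
  (1, ⟨-((truncId p q).transpose * x.l * truncId p q), by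
    rw [LieAlgebra.Orthogonal.mem_so]
    have h : x.l.transpose = -x.l := (LieAlgebra.Orthogonal.mem_so _ _ x.2.1).1 x.2.2
    simp [Matrix.transpose_mul, h, Matrix.mul_assoc]⟩)

theorem truncId_transpose_mul {p q : ℕ} (hqp : q ≤ p) :
    (truncId p q).transpose * truncId p q = 1 := by
  ext i j
  rw [Matrix.mul_apply, Finset.sum_eq_single (Fin.castLE hqp i)]
  · simp [truncId, Matrix.one_apply, Fin.ext_iff]
  · intro b _ hb
    have : b.val ≠ i.val := fun h => hb (Fin.ext h)
    simp [truncId, this]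
  · simp

theorem kowConstraint_iff {p q : ℕ} (hqp : q ≤ p) (x : CotSO p) (z : CotSO q) :
    KowConstraint x z ↔ z = kowPoint q x := by
  have hE := truncId_transpose_mul hqp
  set E := truncId p q with hEdef
  constructor
  · rintro ⟨h1, h2⟩
    refine Prod.ext (Subtype.ext h2) (Subtype.ext ?_)
    change z.l = -(E.transpose * x.l * E)
    have h3 := congrArg (fun M => E.transpose * M * E) h1
    have h4 : E.transpose * (E * z.l * E.transpose + E * E.transpose * x.l * (E * E.transpose)) * E
        = (E.transpose * E) * z.l * (E.transpose * E)
          + (E.transpose * E) * (E.transpose * x.l * E) * (E.transpose * E) := by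
      simp only [Matrix.mul_add, Matrix.add_mul, Matrix.mul_assoc]
    simp only [← hEdef] at h3
    rw [h4, hE] at h3
    simpa [eq_neg_iff_add_eq_zero] using h3
  · rintro rfl
    refine ⟨?_, rfl⟩
    change E * (-(E.transpose * x.l * E)) * E.transpose
      + E * E.transpose * x.l * (E * E.transpose) = 0
    simp only [Matrix.mul_neg, Matrix.neg_mul, Matrix.mul_assoc, neg_add_cancel]

/-- The rest-frame Lax matrix `L^{Kow}(λ)` of the generalized `p`-dimensional Kowalevski top. -/
def laxKow {p q : ℕ} (F : Matrix (Fin p) (Fin q) ℝ) (x : CotSO p) (lam : ℂ) :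
    Matrix (Blk p q) (Blk p q) ℂ :=
  lam • toC (Matrix.fromBlocks 0 (x.k * truncId p q) ((truncId p q).transpose * x.k.transpose) 0)
    - toC (Matrix.fromBlocks (x.k * x.l * x.k.transpose) 0 0
        (-((truncId p q).transpose * x.l * truncId p q)))
    + lam⁻¹ • toC (Matrix.fromBlocks 0 F F.transpose 0)

/-- The reduction of `L_y(λ)`, taken with `A = E`, by the constraints `m + PℓP = 0`, `r = 1`. -/
def laxYKow {p q : ℕ} (F : Matrix (Fin p) (Fin q) ℝ) (c : ℂ) (x : CotSO p) (lam : ℂ) :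
    Matrix (Blk p q) (Blk p q) ℂ :=
  laxY (truncId p q) F c x (kowPoint q x) lam

/-- `L^{Kow}(λ)` is the reduction of `L(λ)`, taken with `A = E`. -/
theorem lax_kowPoint {p q : ℕ} (F : Matrix (Fin p) (Fin q) ℝ) (x : CotSO p) (lam : ℂ) :
    lax (truncId p q) F x (kowPoint q x) lam = laxKow F x lam := by
  have h1 : (kowPoint q x).k = 1 := rfl
  have h2 : (kowPoint q x).l = -((truncId p q).transpose * x.l * truncId p q) := rfl
  simp only [lax, laxKow, laxA, laxL, laxS, h1, h2, Matrix.transpose_one, Matrix.mul_one,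
    Matrix.one_mul, sub_eq_add_neg]

/-! ### Kernels, the `r`-matrix relation and involutivity -/

/-- `P_f = ∑ Z_α ⊗ Z_α`, over the basis of `so(p) ⊕ so(q)` formed by the block matrices
`E_{ij} - E_{ji}` with `i < j`. -/
def casimirF (p q : ℕ) : Matrix (Blk p q × Blk p q) (Blk p q × Blk p q) ℂ :=
  (∑ i : Fin p, ∑ j ∈ Finset.Ioi i,
      toC (Matrix.fromBlocks (gen i j).1 0 0 (0 : Matrix (Fin q) (Fin q) ℝ))
        ⊗ₖ toC (Matrix.fromBlocks (gen i j).1 0 0 (0 : Matrix (Fin q) (Fin q) ℝ)))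
    + ∑ i : Fin q, ∑ j ∈ Finset.Ioi i,
      toC (Matrix.fromBlocks (0 : Matrix (Fin p) (Fin p) ℝ) 0 0 (gen i j).1)
        ⊗ₖ toC (Matrix.fromBlocks (0 : Matrix (Fin p) (Fin p) ℝ) 0 0 (gen i j).1)

/-- `P_p = ∑ S_β ⊗ S_β`, over the symmetric block matrices `S_β` with off-diagonal blocks
`E_{ij}` and `E_{ji}`. -/
def casimirP (p q : ℕ) : Matrix (Blk p q × Blk p q) (Blk p q × Blk p q) ℂ :=
  ∑ i : Fin p, ∑ j : Fin q,
    toC (Matrix.fromBlocks 0 (Matrix.single i j 1) (Matrix.single j i 1) 0)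
      ⊗ₖ toC (Matrix.fromBlocks 0 (Matrix.single i j 1) (Matrix.single j i 1) 0)

/-- `r₁₂(λ, μ) = -λ² / (λ² - μ²) P_f + λ μ / (λ² - μ²) P_p`. -/
def rKernel (p q : ℕ) (lam mu : ℂ) : Matrix (Blk p q × Blk p q) (Blk p q × Blk p q) ℂ :=
  (-(lam ^ 2 / (lam ^ 2 - mu ^ 2))) • casimirF p q
    + (lam * mu / (lam ^ 2 - mu ^ 2)) • casimirP p q

/-- `r₁₂^y(λ, μ) = [1 ⊗ (1 - μ⁻¹ y)⁻¹] r₁₂(λ, μ) [(1 - λ⁻¹ y) ⊗ 1]`. -/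
def rKernelY {p q : ℕ} (F : Matrix (Fin p) (Fin q) ℝ) (c : ℂ) (lam mu : ℂ) :
    Matrix (Blk p q × Blk p q) (Blk p q × Blk p q) ℂ :=
  ((1 : Matrix (Blk p q) (Blk p q) ℂ) ⊗ₖ (1 - mu⁻¹ • yMat F c)⁻¹) * rKernel p q lam mu
    * ((1 - lam⁻¹ • yMat F c) ⊗ₖ (1 : Matrix (Blk p q) (Blk p q) ℂ))

/-- The permutation operator `Π`, with `Π (X ⊗ Y) = (Y ⊗ X) Π`. -/
def permOp (n : Type) [DecidableEq n] : Matrix (n × n) (n × n) ℂ :=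
  Matrix.of fun a b => if a = b.swap then 1 else 0

theorem permOp_mul_kronecker {n : Type} [Fintype n] [DecidableEq n] (X Y : Matrix n n ℂ) :
    permOp n * (X ⊗ₖ Y) = (Y ⊗ₖ X) * permOp n := by
  ext ⟨a, b⟩ ⟨d, e⟩
  simp [permOp, Matrix.mul_apply, Fintype.sum_prod_type, ite_and, Prod.ext_iff, mul_comm]

/-- The matrix `{L₁(λ), L₂(μ)}`: its entry in row `(i, m)` and column `(j, n)` is
`{L_{ij}(λ), L_{mn}(μ)}`. -/
def tensorBracket {p : ℕ} {n : Type} (L : CotSO p → ℂ → Matrix n n ℂ) (lam mu : ℂ)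
    (x : CotSO p) : Matrix (n × n) (n × n) ℂ :=
  Matrix.of fun a b =>
    bracket (fun z => L z lam a.1 b.1) (fun z => L z mu a.2 b.2) x

/-- The `r`-matrix relation
`-{L₁(λ), L₂(μ)} = [r₁₂(λ, μ), L₁(λ)] - [r₂₁(λ, μ), L₂(μ)]`, `r₂₁(λ, μ) = Π r₁₂(μ, λ) Π`,
for all `λ, μ` in `D` with `λ² ≠ μ²`, at all points of `T^*SO(p)`. The minus sign comes from the
sign convention of the bracket: `-{·, ·}` is the opposite Poisson bracket. -/
def SatisfiesRMatrix {p : ℕ} {n : Type} [Fintype n] [DecidableEq n]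
    (L : CotSO p → ℂ → Matrix n n ℂ) (r : ℂ → ℂ → Matrix (n × n) (n × n) ℂ) (D : Set ℂ) : Prop :=
  ∀ lam ∈ D, ∀ mu ∈ D, lam ^ 2 ≠ mu ^ 2 → ∀ x : CotSO p,
    -tensorBracket L lam mu x =
      ⁅r lam mu, L x lam ⊗ₖ (1 : Matrix n n ℂ)⁆
        - ⁅permOp n * r mu lam * permOp n, (1 : Matrix n n ℂ) ⊗ₖ L x mu⁆

/-- Involutivity of the spectral invariants of `L(λ)`, `λ ∈ D`: both the traces of powers and the
coefficients of the characteristic polynomial Poisson commute, for all values of the spectral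
parameters and at all points of `T^*SO(p)`. -/
def SpectralInvolution {p : ℕ} {n : Type} [Fintype n] [DecidableEq n]
    (L : CotSO p → ℂ → Matrix n n ℂ) (D : Set ℂ) : Prop :=
  ∀ lam ∈ D, ∀ mu ∈ D, ∀ x : CotSO p,
    (∀ i j : ℕ, bracket (fun z => (L z lam ^ i).trace) (fun z => (L z mu ^ j).trace) x = 0) ∧
    (∀ i j : ℕ, bracket (fun z => (L z lam).charpoly.coeff i)
      (fun z => (L z mu).charpoly.coeff j) x = 0)

/-- The values of `λ` at which `L_y(λ)` is defined: `λ ≠ 0` and `1 - λ⁻¹ y` is invertible. -/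
def domY {p q : ℕ} (F : Matrix (Fin p) (Fin q) ℝ) (c : ℂ) : Set ℂ :=
  {lam | lam ≠ 0 ∧ IsUnit (1 - lam⁻¹ • yMat F c)}

end KowalevskiTop

end

noncomputable section

namespace KowalevskiTop

/-! ### The Casimir kernels -/

/-! The undeformed statement is the case `c = 0` of the deformed one, so only `L_y` is treated.
Write `H = 1 - λ⁻¹y`, `G = H⁻¹`, `L_y = G N`, with `H'`, `G'`, `N'` the same objects at `μ`. Since
`G` is constant on phase space, `{L_y(λ)₁, L_y(μ)₂} = (G ⊗ G') {N₁, N'₂}`, and only the numerators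
have to be bracketed.

On the reduced space the entries of `a` and `l` close under the bracket: `{l₁, l₂} = [P_f, l₁]`,
`{l₁, a₂} = [a₂, P_f]`, `{a₁, l₂} = -[a₁, P_f]`, `{a₁, a₂} = 0` (`pairing_lVel`,
`sum_lFibreVel_kronecker_aVel`, `sum_aVel_kronecker_lFibreVel`). The two diagonal blocks of `l` come
from `kℓkᵀ` and `ℓ`, which generate rotations of `k` on opposite sides and hence commute; `k kᵀ = 1`
and `Eᵀ E = 1` make each block act on `kE` in the standard way.

Substituting these brackets leaves a purely algebraic identity (`rMatrix_identity`): `-{N₁, N'₂}`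
equals `H₁ r N₁ - N₁ r H₁` minus the analogous expression in the second factor, with `r(μ, λ)`,
`H'`, `N'`. Multiplication by `G ⊗ G'` turns the twisted commutators into genuine ones with the
dressed kernel `r^y` (`kronecker_mul_dressing`), which is the `r`-matrix relation.

For involutivity, the bracket of `φ(L(λ))` and `ψ(L(μ))` is `dφ ⊗ dψ` applied to `{L₁, L₂}`
(`bracket_comp`). If `φ` and `ψ` are conjugation invariant, their differentials kill commutators
with `L`, so the right-hand side of the `r`-matrix relation is annihilated. At `λ² = μ²`, where `r`
is singular, the bracket still depends continuously on `μ` and is a limit of zeros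
(`bracket_eq_zero_of_eventually`). -/

theorem casimirF_apply {p q : ℕ} (a b c d : Blk p q) :
    casimirF p q (a, b) (c, d) =
      if a.isLeft = c.isLeft then
        (1 : Matrix (Blk p q) (Blk p q) ℂ) a b * (1 : Matrix (Blk p q) (Blk p q) ℂ) c d
          - (1 : Matrix (Blk p q) (Blk p q) ℂ) a d * (1 : Matrix (Blk p q) (Blk p q) ℂ) b c
      else 0 := by
  have key : ∀ {n : ℕ} (a b c d : Fin n),
      ∑ i, ∑ j ∈ Finset.Ioi i, ((gen i j).1 a c : ℂ) * ((gen i j).1 b d : ℂ) =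
        (1 : Matrix (Fin n) (Fin n) ℂ) a b * (1 : Matrix (Fin n) (Fin n) ℂ) c d
          - (1 : Matrix (Fin n) (Fin n) ℂ) a d * (1 : Matrix (Fin n) (Fin n) ℂ) b c := by
    intro n a b c d
    rw [sum_gen a c (fun i j => ((gen i j).1 b d : ℂ))]
    · rw [gen_apply]
      simp only [Matrix.one_apply]
      split_ifs <;> first | (norm_num; done) | (exfalso; grind)
    · intro i j
      have : (gen j i).1 = -(gen i j).1 := by simp [gen]
      rw [this]
      simp
  rcases a with a | a <;> rcases b with b | b <;> rcases c with c | c <;> rcases d with d | d <;>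
    simp [casimirF, toC, Matrix.add_apply, Matrix.sum_apply, key]
  all_goals simp [Matrix.one_apply]

theorem casimirP_apply {p q : ℕ} (a b c d : Blk p q) :
    casimirP p q (a, b) (c, d) =
      if a.isLeft = c.isLeft then 0 else
        (1 : Matrix (Blk p q) (Blk p q) ℂ) a b * (1 : Matrix (Blk p q) (Blk p q) ℂ) c d
          + (1 : Matrix (Blk p q) (Blk p q) ℂ) a d * (1 : Matrix (Blk p q) (Blk p q) ℂ) b c := by
  rcases a with a | a <;> rcases b with b | b <;> rcases c with c | c <;> rcases d with d | d <;>
    simp [casimirP, toC, Matrix.sum_apply, Matrix.single_apply, Matrix.one_apply, ite_and,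
      apply_ite Complex.ofReal, eq_comm]
  all_goals split_ifs <;> rfl

/-- The combination `u P_f + v P_p`. -/
def kernel (p q : ℕ) (u v : ℂ) : Matrix (Blk p q × Blk p q) (Blk p q × Blk p q) ℂ :=
  u • casimirF p q + v • casimirP p q

theorem kernel_apply {p q : ℕ} (u v : ℂ) (a b c d : Blk p q) :
    kernel p q u v (a, b) (c, d) =
      if a.isLeft = c.isLeft then
        u * ((1 : Matrix (Blk p q) (Blk p q) ℂ) a b * (1 : Matrix (Blk p q) (Blk p q) ℂ) c d
          - (1 : Matrix (Blk p q) (Blk p q) ℂ) a d * (1 : Matrix (Blk p q) (Blk p q) ℂ) b c)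
      else
        v * ((1 : Matrix (Blk p q) (Blk p q) ℂ) a b * (1 : Matrix (Blk p q) (Blk p q) ℂ) c d
          + (1 : Matrix (Blk p q) (Blk p q) ℂ) a d * (1 : Matrix (Blk p q) (Blk p q) ℂ) b c) := by
  simp only [kernel, Matrix.add_apply, Matrix.smul_apply, casimirF_apply, casimirP_apply,
    smul_eq_mul]
  split_ifs <;> ring

theorem rKernel_eq (p q : ℕ) (lam mu : ℂ) :
    rKernel p q lam mu =
      kernel p q (-(lam ^ 2 / (lam ^ 2 - mu ^ 2))) (lam * mu / (lam ^ 2 - mu ^ 2)) := rfl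

theorem casimirF_eq (p q : ℕ) : casimirF p q = kernel p q 1 0 := by simp [kernel]

theorem permOp_mul_mul_apply {n : Type} [Fintype n] [DecidableEq n]
    (T : Matrix (n × n) (n × n) ℂ) (a b c d : n) :
    (permOp n * T * permOp n) (a, b) (c, d) = T (b, a) (d, c) := by
  simp [permOp, Matrix.mul_apply, Fintype.sum_prod_type, ite_and, Prod.ext_iff]

/-- Both kernels are sums of squares `Z ⊗ Z`, so exchanging the factors changes nothing. Hence
passing from `r₁₂` to `r₂₁` only exchanges the spectral parameters. -/
theorem permOp_kernel (p q : ℕ) (u v : ℂ) :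
    permOp (Blk p q) * kernel p q u v * permOp (Blk p q) = kernel p q u v := by
  ext ⟨a, b⟩ ⟨c, d⟩
  rw [permOp_mul_mul_apply, kernel_apply, kernel_apply]
  simp only [Matrix.one_apply]
  grind

/-- On the support of the deltas, `a, c` lie in the same block exactly when `b, d` do. Testing the
second pair lets the condition leave a sum over the first tensor factor. -/
theorem kernel_apply' {p q : ℕ} (u v : ℂ) (a b c d : Blk p q) :
    kernel p q u v (a, b) (c, d) =
      if b.isLeft = d.isLeft then
        u * ((1 : Matrix (Blk p q) (Blk p q) ℂ) a b * (1 : Matrix (Blk p q) (Blk p q) ℂ) c d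
          - (1 : Matrix (Blk p q) (Blk p q) ℂ) a d * (1 : Matrix (Blk p q) (Blk p q) ℂ) b c)
      else
        v * ((1 : Matrix (Blk p q) (Blk p q) ℂ) a b * (1 : Matrix (Blk p q) (Blk p q) ℂ) c d
          + (1 : Matrix (Blk p q) (Blk p q) ℂ) a d * (1 : Matrix (Blk p q) (Blk p q) ℂ) b c) := by
  rw [kernel_apply]
  simp only [Matrix.one_apply]
  grind

/-! ### Kernels sandwiched between matrices in one tensor factor. -/

theorem sandwich_left_apply {n : Type} [Fintype n] [DecidableEq n] (Y X : Matrix n n ℂ)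
    (T : Matrix (n × n) (n × n) ℂ) (a b c d : n) :
    ((Y ⊗ₖ (1 : Matrix n n ℂ)) * T * (X ⊗ₖ (1 : Matrix n n ℂ))) (a, b) (c, d) =
      ∑ f, ∑ e, Y a e * T (e, b) (f, d) * X f c := by
  simp [Matrix.mul_apply, Fintype.sum_prod_type, Matrix.one_apply, Finset.sum_mul]

theorem sandwich_right_apply {n : Type} [Fintype n] [DecidableEq n] (Y X : Matrix n n ℂ)
    (T : Matrix (n × n) (n × n) ℂ) (a b c d : n) :
    (((1 : Matrix n n ℂ) ⊗ₖ Y) * T * ((1 : Matrix n n ℂ) ⊗ₖ X)) (a, b) (c, d) =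
      ∑ f, ∑ e, Y b e * T (a, e) (c, f) * X f d := by
  simp [Matrix.mul_apply, Fintype.sum_prod_type, Matrix.one_apply, Finset.sum_mul]

/-- The deltas of the kernel absorb both summations, so each entry is a quadratic expression in
entries of `Y` and `X` with no internal sum. This is what later lets `ring` verify the `r`-matrix
identity entrywise. -/
theorem kernel_sandwich_left {p q : ℕ} (u v : ℂ) (Y X : Matrix (Blk p q) (Blk p q) ℂ)
    (a b c d : Blk p q) :
    ((Y ⊗ₖ (1 : Matrix (Blk p q) (Blk p q) ℂ)) * kernel p q u v
        * (X ⊗ₖ (1 : Matrix (Blk p q) (Blk p q) ℂ))) (a, b) (c, d) =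
      if b.isLeft = d.isLeft then u * (Y a b * X d c - Y a d * X b c)
      else v * (Y a b * X d c + Y a d * X b c) := by
  rw [sandwich_left_apply]
  simp only [kernel_apply']
  split_ifs <;>
  · simp only [Matrix.one_apply, mul_sub, sub_mul, mul_add, add_mul, Finset.sum_sub_distrib,
      Finset.sum_add_distrib]
    simp
    ring

theorem kernel_sandwich_right {p q : ℕ} (u v : ℂ) (Y X : Matrix (Blk p q) (Blk p q) ℂ)
    (a b c d : Blk p q) :
    (((1 : Matrix (Blk p q) (Blk p q) ℂ) ⊗ₖ Y) * kernel p q u v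
        * ((1 : Matrix (Blk p q) (Blk p q) ℂ) ⊗ₖ X)) (a, b) (c, d) =
      if a.isLeft = c.isLeft then u * (Y b a * X c d - Y b c * X a d)
      else v * (Y b a * X c d + Y b c * X a d) := by
  rw [sandwich_right_apply]
  simp only [kernel_apply]
  split_ifs <;>
  · simp only [Matrix.one_apply, mul_sub, sub_mul, mul_add, add_mul, Finset.sum_sub_distrib,
      Finset.sum_add_distrib]
    simp
    ring

/-! ### Sums over the generators of `so(p)` -/

theorem gen_swap {p : ℕ} (i j : Fin p) : (gen j i).1 = -(gen i j).1 := by simp [gen]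

theorem mul_gen_mul_apply {p : ℕ} {m n : Type} (P : Matrix m (Fin p) ℝ) (Q : Matrix (Fin p) n ℝ)
    (i j : Fin p) (a : m) (c : n) :
    (P * (gen i j).1 * Q) a c = P a i * Q j c - P a j * Q i c := by
  simp [Matrix.mul_apply, gen_apply, mul_sub, sub_mul, Finset.sum_sub_distrib, ite_and]

/-- An antisymmetric `G` summed against the generators with `i < j` reproduces `G` (`sum_gen`);
linearity carries this through the outer factors and yields an unrestricted double sum. -/
theorem sum_mul_gen_mul {p : ℕ} {m n : Type} (R : Matrix m (Fin p) ℝ) (S : Matrix (Fin p) n ℝ)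
    (b : m) (d : n) (G : Fin p → Fin p → ℂ) (hG : ∀ i j, G j i = -G i j) :
    ∑ i, ∑ j ∈ Finset.Ioi i, (((R * (gen i j).1 * S : Matrix _ _ ℝ) b d : ℝ) : ℂ) * G i j =
      ∑ i, ∑ j, (R b i : ℂ) * S j d * G i j := by
  have h : ∀ i j, (((R * (gen i j).1 * S : Matrix _ _ ℝ) b d : ℝ) : ℂ) =
      ∑ k, ∑ l, (R b k : ℂ) * S l d * ((gen i j).1 k l : ℂ) := by
    intro i j
    simp only [Matrix.mul_apply, Finset.sum_mul]
    push_cast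
    rw [Finset.sum_comm]
    exact Finset.sum_congr rfl fun k _ => Finset.sum_congr rfl fun l _ => by ring
  simp only [h, Finset.sum_mul]
  have h2 : ∀ i, ∑ j ∈ Finset.Ioi i, ∑ k, ∑ l,
      (R b k : ℂ) * S l d * ((gen i j).1 k l : ℂ) * G i j =
      ∑ k, ∑ l, ∑ j ∈ Finset.Ioi i, (R b k : ℂ) * S l d * (((gen i j).1 k l : ℂ) * G i j) := by
    intro i
    rw [Finset.sum_comm]
    refine Finset.sum_congr rfl fun k _ => ?_
    rw [Finset.sum_comm]
    simp only [mul_assoc]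
  simp only [h2]
  rw [Finset.sum_comm]
  refine Finset.sum_congr rfl fun k _ => ?_
  rw [Finset.sum_comm]
  refine Finset.sum_congr rfl fun l _ => ?_
  simp only [← Finset.mul_sum]
  rw [sum_gen k l G hG]

/-- The Casimir identity for `so(p)`, sandwiched between arbitrary matrices. -/
theorem sum_gen_gen {p : ℕ} {m n m' n' : Type} (P : Matrix m (Fin p) ℝ) (Q : Matrix (Fin p) n ℝ)
    (R : Matrix m' (Fin p) ℝ) (S : Matrix (Fin p) n' ℝ) (a : m) (c : n) (b : m') (d : n') :
    ∑ i : Fin p, ∑ j ∈ Finset.Ioi i,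
        (((P * (gen i j).1 * Q : Matrix m n ℝ) a c : ℝ) : ℂ) * (((R * (gen i j).1 * S : Matrix _ _ ℝ) b d : ℝ) : ℂ) =
      (((P * R.transpose) a b * (Q.transpose * S) c d - (P * S) a d * (R * Q) b c : ℝ) : ℂ) := by
  rw [sum_mul_gen_mul P Q a c (fun i j => (((R * (gen i j).1 * S : Matrix _ _ ℝ) b d : ℝ) : ℂ))]
  · norm_cast
    simp only [mul_gen_mul_apply]
    simp only [Matrix.mul_apply, Matrix.transpose_apply, Finset.sum_mul_sum,
      ← Finset.sum_sub_distrib]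
    exact Finset.sum_congr rfl fun i _ => Finset.sum_congr rfl fun j _ => by ring
  · intro i j
    rw [gen_swap]
    simp

/-- The structure functions of `so(p)`, sandwiched between arbitrary matrices. -/
theorem sum_gen_gen_structFun {p : ℕ} {m n m' n' : Type} (x : CotSO p) (P : Matrix m (Fin p) ℝ)
    (Q : Matrix (Fin p) n ℝ) (R : Matrix m' (Fin p) ℝ) (S : Matrix (Fin p) n' ℝ)
    (a : m) (c : n) (b : m') (d : n') :
    ∑ i : Fin p, ∑ j ∈ Finset.Ioi i, ∑ k : Fin p, ∑ l ∈ Finset.Ioi k,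
        (structFun x i j k l : ℂ) * ((((P * (gen i j).1 * Q : Matrix m n ℝ) a c : ℝ) : ℂ) *
          (((R * (gen k l).1 * S : Matrix m' n' ℝ) b d : ℝ) : ℂ)) =
      (((P * S) a d * (Q.transpose * x.l * R.transpose) c b
        + (R * Q) b c * (P * x.l * S) a d
        - (P * R.transpose) a b * (Q.transpose * x.l * S) c d
        - (Q.transpose * S) c d * (P * x.l * R.transpose) a b : ℝ) : ℂ) := by
  have hl : ∀ a b, x.l b a = -x.l a b := fun a b =>
    congrFun (congrFun ((LieAlgebra.Orthogonal.mem_so _ _ x.2.1).1 x.2.2) a) b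
  have h1 : ∀ i j, ∑ k : Fin p, ∑ l ∈ Finset.Ioi k, (((R * (gen k l).1 * S : Matrix _ _ ℝ) b d : ℝ) : ℂ) *
      (structFun x i j k l : ℂ) = ∑ k, ∑ l, (R b k : ℂ) * S l d * (structFun x i j k l : ℂ) := by
    intro i j
    refine sum_mul_gen_mul R S b d (fun k l => (structFun x i j k l : ℂ)) fun k l => ?_
    rw [← Complex.ofReal_neg]
    congr 1
    simp only [structFun]
    split_ifs <;> grind
  have h2 : ∀ i j, ∑ k : Fin p, ∑ l ∈ Finset.Ioi k,
      (((P * (gen i j).1 * Q : Matrix m n ℝ) a c : ℝ) : ℂ) *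
        (((R * (gen k l).1 * S : Matrix m' n' ℝ) b d : ℝ) : ℂ) * (structFun x i j k l : ℂ) =
      (((P * (gen i j).1 * Q : Matrix m n ℝ) a c : ℝ) : ℂ) *
        ∑ k, ∑ l, (R b k : ℂ) * S l d * (structFun x i j k l : ℂ) := by
    intro i j
    rw [← h1, Finset.mul_sum]
    refine Finset.sum_congr rfl fun k _ => ?_
    rw [Finset.mul_sum]
    exact Finset.sum_congr rfl fun l _ => mul_assoc _ _ _
  simp only [mul_comm (Complex.ofReal (structFun _ _ _ _ _)) (Complex.ofReal _ * _), h2]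
  rw [sum_mul_gen_mul P Q a c
    (fun i j => ∑ k, ∑ l, (R b k : ℂ) * S l d * (structFun x i j k l : ℂ))]
  · norm_cast
    -- Each of the four deltas in `structFun` removes one summation.
    have e : ∀ i j, ∑ k, ∑ l, R b k * S l d * structFun x i j k l =
        S i d * (∑ k, x.l j k * R b k) + R b j * (∑ l, x.l i l * S l d)
          - R b i * (∑ l, x.l j l * S l d) - S j d * (∑ k, x.l i k * R b k) := by
      intro i j
      simp only [structFun, mul_add, mul_sub, Finset.sum_add_distrib, Finset.sum_sub_distrib,
        mul_ite, mul_zero, Finset.sum_ite_eq, Finset.mem_univ, if_true]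
      simp only [Finset.sum_ite_irrel, Finset.sum_const_zero, Finset.sum_ite_eq, Finset.mem_univ,
        if_true, Finset.mul_sum]
      congr 1
      congr 1
      congr 1
      all_goals exact Finset.sum_congr rfl fun k _ => by ring
    simp only [e]
    -- Each remaining term separates in `i` and `j`, so its double sum is a product of two matrix
    -- entries.
    have f : ∀ (u v w z : Fin p → ℝ), ∑ i, ∑ j, u i * v j * (w i * z j) =
        (∑ i, u i * w i) * ∑ j, v j * z j := by
      intro u v w z
      rw [Finset.sum_mul_sum]
      exact Finset.sum_congr rfl fun i _ => Finset.sum_congr rfl fun j _ => by ring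
    have e1 := f (P a) (Q · c) (S · d) (fun j => ∑ k, x.l j k * R b k)
    have e2 := f (P a) (Q · c) (fun i => ∑ l, x.l i l * S l d) (R b)
    have e3 := f (P a) (Q · c) (R b) (fun j => ∑ l, x.l j l * S l d)
    have e4 := f (P a) (Q · c) (fun i => ∑ k, x.l i k * R b k) (S · d)
    simp only [mul_sub, mul_add, Finset.sum_add_distrib, Finset.sum_sub_distrib, Matrix.mul_assoc]
    rw [e1, e3]
    simp only [mul_comm (R b _) (∑ l, _), mul_comm (S _ d) (∑ l, _)]
    rw [e2, e4]
    simp only [Matrix.mul_apply, Matrix.transpose_apply]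
    rw [Finset.sum_congr rfl fun j _ => mul_comm (Q j c) (R b j)]
    ring
  · intro i j
    simp only [← Finset.sum_neg_distrib]
    refine Finset.sum_congr rfl fun k _ => Finset.sum_congr rfl fun l _ => ?_
    have : structFun x j i k l = -structFun x i j k l := by
      simp only [structFun]
      split_ifs <;> grind
    rw [this]
    push_cast
    ring

/-! ### Derivatives of matrix functions and their brackets -/

/-- `dF X` and `dL X` are the entrywise derivatives at `x` of `L` in the direction `X` of the fibre
and along the left-invariant field of `X`. -/
structure HasVelocity {p : ℕ} {n : Type} (L : CotSO p → Matrix n n ℂ) (x : CotSO p)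
    (dF dL : LieAlgebra.Orthogonal.so (Fin p) ℝ → Matrix n n ℂ) : Prop where
  fibre : ∀ X a b, HasDerivAt (fun t : ℝ => L (x.1, x.2 + t • X) a b) (dF X a b) 0
  left : ∀ X a b, HasDerivAt (fun t : ℝ => L (x.1 * expSO (t • X), x.2) a b) (dL X a b) 0

/-- The tensor bracket of two matrix functions with given derivatives. -/
def pairing {p : ℕ} {n : Type} (x : CotSO p)
    (dF dL dF' dL' : LieAlgebra.Orthogonal.so (Fin p) ℝ → Matrix n n ℂ) :
    Matrix (n × n) (n × n) ℂ :=
  (∑ i, ∑ j ∈ Finset.Ioi i,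
      (dF (gen i j) ⊗ₖ dL' (gen i j) - dL (gen i j) ⊗ₖ dF' (gen i j)))
    + ∑ i, ∑ j ∈ Finset.Ioi i, ∑ k, ∑ l ∈ Finset.Ioi k,
        (structFun x i j k l : ℂ) • (dF (gen i j) ⊗ₖ dF' (gen k l))

theorem tensorBracket_eq_pairing {p : ℕ} {n : Type} {L : CotSO p → ℂ → Matrix n n ℂ} {lam mu : ℂ}
    {x : CotSO p} {dF dL dF' dL' : LieAlgebra.Orthogonal.so (Fin p) ℝ → Matrix n n ℂ}
    (h : HasVelocity (fun z => L z lam) x dF dL) (h' : HasVelocity (fun z => L z mu) x dF' dL') :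
    tensorBracket L lam mu x = pairing x dF dL dF' dL' := by
  ext ⟨a, b⟩ ⟨c, d⟩
  simp only [tensorBracket, Matrix.of_apply, bracket, fibreDeriv, leftDeriv, (h.fibre _ _ _).deriv,
    (h.left _ _ _).deriv, (h'.fibre _ _ _).deriv, (h'.left _ _ _).deriv, pairing, Matrix.add_apply,
    Matrix.sum_apply, Matrix.sub_apply, Matrix.smul_apply, Matrix.kronecker_apply, smul_eq_mul]
  congr 1
  refine Finset.sum_congr rfl fun i _ => Finset.sum_congr rfl fun j _ =>
    Finset.sum_congr rfl fun k _ => Finset.sum_congr rfl fun l _ => by ring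

theorem pairing_mul_left {p : ℕ} {n : Type} [Fintype n] (x : CotSO p) (G G' : Matrix n n ℂ)
    (dF dL dF' dL' : LieAlgebra.Orthogonal.so (Fin p) ℝ → Matrix n n ℂ) :
    pairing x (fun X => G * dF X) (fun X => G * dL X) (fun X => G' * dF' X) (fun X => G' * dL' X) =
      (G ⊗ₖ G') * pairing x dF dL dF' dL' := by
  simp only [pairing, Matrix.mul_kronecker_mul, Matrix.mul_add, Finset.mul_sum, Matrix.mul_sub,
    Matrix.mul_smul]

/-- The functional `X ⊗ Y ↦ u X * v Y`. -/
def kronFunctional {n : Type} [Fintype n] [DecidableEq n] (u v : Matrix n n ℂ →ₗ[ℂ] ℂ) :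
    Matrix (n × n) (n × n) ℂ →ₗ[ℂ] ℂ where
  toFun T := ∑ a, ∑ c, ∑ b, ∑ d, T (a, b) (c, d) *
    (u (Matrix.single a c 1) * v (Matrix.single b d 1))
  map_add' S T := by simp only [Matrix.add_apply, add_mul, Finset.sum_add_distrib]
  map_smul' t T := by
    simp only [Matrix.smul_apply, smul_eq_mul, mul_assoc, ← Finset.mul_sum, RingHom.id_apply]

theorem linearMap_eq_sum_single {n : Type} [Fintype n] [DecidableEq n] (u : Matrix n n ℂ →ₗ[ℂ] ℂ)
    (M : Matrix n n ℂ) : u M = ∑ a, ∑ c, M a c * u (Matrix.single a c 1) := by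
  conv_lhs => rw [Matrix.matrix_eq_sum_single M]
  simp only [map_sum]
  refine Finset.sum_congr rfl fun a _ => Finset.sum_congr rfl fun c _ => ?_
  rw [← smul_eq_mul, ← map_smul, Matrix.smul_single, smul_eq_mul, mul_one]

theorem kronFunctional_kronecker {n : Type} [Fintype n] [DecidableEq n]
    (u v : Matrix n n ℂ →ₗ[ℂ] ℂ) (X Y : Matrix n n ℂ) :
    kronFunctional u v (X ⊗ₖ Y) = u X * v Y := by
  rw [linearMap_eq_sum_single u X, linearMap_eq_sum_single v Y]
  simp only [kronFunctional, LinearMap.coe_mk, AddHom.coe_mk, Matrix.kronecker_apply,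
    Finset.sum_mul]
  simp only [Finset.mul_sum]
  refine Finset.sum_congr rfl fun a _ => Finset.sum_congr rfl fun c _ =>
    Finset.sum_congr rfl fun b _ => Finset.sum_congr rfl fun d _ => by ring

theorem kronFunctional_pairing {p : ℕ} {n : Type} [Fintype n] [DecidableEq n]
    (u v : Matrix n n ℂ →ₗ[ℂ] ℂ) (x : CotSO p)
    (dF dL dF' dL' : LieAlgebra.Orthogonal.so (Fin p) ℝ → Matrix n n ℂ) :
    kronFunctional u v (pairing x dF dL dF' dL') =
      (∑ i, ∑ j ∈ Finset.Ioi i,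
        (u (dF (gen i j)) * v (dL' (gen i j)) - u (dL (gen i j)) * v (dF' (gen i j))))
      + ∑ i, ∑ j ∈ Finset.Ioi i, ∑ k, ∑ l ∈ Finset.Ioi k,
        (structFun x i j k l : ℂ) * (u (dF (gen i j)) * v (dF' (gen k l))) := by
  simp only [pairing, map_add, map_sum, map_sub, map_smul, kronFunctional_kronecker, smul_eq_mul]

theorem matrix_eq_sum_kronecker {n : Type} [Fintype n] [DecidableEq n]
    (T : Matrix (n × n) (n × n) ℂ) :
    T = ∑ a, ∑ c, ∑ b, ∑ d, T (a, b) (c, d) •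
      ((Matrix.single a c (1 : ℂ)) ⊗ₖ (Matrix.single b d (1 : ℂ))) := by
  ext ⟨a, b⟩ ⟨c, d⟩
  simp [Matrix.sum_apply, Matrix.single_apply, ite_and]

/-- On elementary tensors `[X ⊗ Y, M ⊗ 1] = [X, M] ⊗ Y`, on which the functional is `u [X, M] * v Y
= 0`; such tensors span. -/
theorem kronFunctional_commutator_left {n : Type} [Fintype n] [DecidableEq n]
    (u v : Matrix n n ℂ →ₗ[ℂ] ℂ) (M : Matrix n n ℂ) (hu : ∀ X, u (X * M - M * X) = 0)
    (T : Matrix (n × n) (n × n) ℂ) :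
    kronFunctional u v ⁅T, M ⊗ₖ (1 : Matrix n n ℂ)⁆ = 0 := by
  rw [matrix_eq_sum_kronecker T, Ring.lie_def]
  simp only [Finset.sum_mul, Finset.mul_sum, map_sub, map_sum, smul_mul_assoc, mul_smul_comm,
    ← Matrix.mul_kronecker_mul, map_smul, kronFunctional_kronecker, mul_one, one_mul,
    ← Finset.sum_sub_distrib, ← smul_sub, ← sub_mul]
  simp only [← map_sub, hu, zero_mul, smul_zero, Finset.sum_const_zero]

theorem kronFunctional_commutator_right {n : Type} [Fintype n] [DecidableEq n]
    (u v : Matrix n n ℂ →ₗ[ℂ] ℂ) (M : Matrix n n ℂ) (hv : ∀ X, v (X * M - M * X) = 0)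
    (T : Matrix (n × n) (n × n) ℂ) :
    kronFunctional u v ⁅T, (1 : Matrix n n ℂ) ⊗ₖ M⁆ = 0 := by
  rw [matrix_eq_sum_kronecker T, Ring.lie_def]
  simp only [Finset.sum_mul, Finset.mul_sum, map_sub, map_sum, smul_mul_assoc, mul_smul_comm,
    ← Matrix.mul_kronecker_mul, map_smul, kronFunctional_kronecker, mul_one, one_mul,
    ← Finset.sum_sub_distrib, ← smul_sub, ← mul_sub]
  simp only [← map_sub, hv, mul_zero, smul_zero, Finset.sum_const_zero]

/-! ### Conjugation-invariant functions of a Lax matrix. -/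

section Spectral

open scoped Matrix.Norms.Operator

theorem hasDerivAt_matrix {m n : Type} [Fintype m] [Fintype n] {𝕜 : Type} [RCLike 𝕜]
    {f : ℝ → Matrix m n 𝕜} {f' : Matrix m n 𝕜} {t : ℝ} :
    HasDerivAt f f' t ↔ ∀ a b, HasDerivAt (fun s => f s a b) (f' a b) t :=
  hasDerivAt_pi.trans (forall_congr' fun _ => hasDerivAt_pi)

theorem HasVelocity.comp {p : ℕ} {n : Type} [Fintype n] [DecidableEq n]
    {L : CotSO p → Matrix n n ℂ}
    {x : CotSO p} {dF dL : LieAlgebra.Orthogonal.so (Fin p) ℝ → Matrix n n ℂ}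
    (h : HasVelocity L x dF dL) {φ : Matrix n n ℂ → ℂ} (hφ : DifferentiableAt ℂ φ (L x))
    (X : LieAlgebra.Orthogonal.so (Fin p) ℝ) :
    fibreDeriv X (fun z => φ (L z)) x = fderiv ℂ φ (L x) (dF X) ∧
      leftDeriv X (fun z => φ (L z)) x = fderiv ℂ φ (L x) (dL X) := by
  -- The curves in phase space have a real parameter, while `φ` is complex differentiable.
  have h1 : HasFDerivAt φ ((fderiv ℂ φ (L x)).restrictScalars ℝ) (L x) :=
    hφ.hasFDerivAt.restrictScalars ℝ
  have hexp : expSO (0 : LieAlgebra.Orthogonal.so (Fin p) ℝ) = 1 := by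
    ext a b
    simp [expSO]
  constructor
  · exact (h1.comp_hasDerivAt_of_eq 0 (hasDerivAt_matrix.2 (h.fibre X)) (by simp)).deriv
  · exact (h1.comp_hasDerivAt_of_eq 0 (hasDerivAt_matrix.2 (h.left X)) (by simp [hexp])).deriv

/-- Chain rule: the bracket is a first-order bidifferential operator, so it sees `φ` and `ψ` only
through their differentials. -/
theorem bracket_comp {p : ℕ} {n : Type} [Fintype n] [DecidableEq n]
    {L : CotSO p → ℂ → Matrix n n ℂ} {lam mu : ℂ}
    {x : CotSO p} {dF dL dF' dL' : LieAlgebra.Orthogonal.so (Fin p) ℝ → Matrix n n ℂ}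
    (h : HasVelocity (fun z => L z lam) x dF dL) (h' : HasVelocity (fun z => L z mu) x dF' dL')
    {φ ψ : Matrix n n ℂ → ℂ} (hφ : Differentiable ℂ φ) (hψ : Differentiable ℂ ψ) :
    bracket (fun z => φ (L z lam)) (fun z => ψ (L z mu)) x =
      kronFunctional (fderiv ℂ φ (L x lam)).toLinearMap (fderiv ℂ ψ (L x mu)).toLinearMap
        (tensorBracket L lam mu x) := by
  rw [tensorBracket_eq_pairing h h', kronFunctional_pairing]
  simp only [bracket, (h.comp hφ.differentiableAt _).1, (h.comp hφ.differentiableAt _).2,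
    (h'.comp hψ.differentiableAt _).1, (h'.comp hψ.differentiableAt _).2,
    ContinuousLinearMap.coe_coe]
  congr 1
  refine Finset.sum_congr rfl fun i _ => Finset.sum_congr rfl fun j _ =>
    Finset.sum_congr rfl fun k _ => Finset.sum_congr rfl fun l _ => by ring

/-- Differentiate the constant function `t ↦ φ(e^{tX} M e^{-tX})` at `t = 0`. -/
theorem fderiv_commutator_eq_zero {n : Type} [Fintype n] [DecidableEq n] {φ : Matrix n n ℂ → ℂ}
    (hφ : Differentiable ℂ φ)
    (hconj : ∀ (U : (Matrix n n ℂ)ˣ) (M : Matrix n n ℂ), φ (U * M * (U⁻¹ : (Matrix n n ℂ)ˣ)) = φ M)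
    (M X : Matrix n n ℂ) : fderiv ℂ φ M (X * M - M * X) = 0 := by
  have h1 : HasDerivAt (fun t : ℂ => NormedSpace.exp (t • X) * M * NormedSpace.exp (t • (-X)))
      (X * M - M * X) 0 := by
    have e1 := hasDerivAt_exp_smul_const (𝕂 := ℂ) X (0 : ℂ)
    have e2 := hasDerivAt_exp_smul_const (𝕂 := ℂ) (-X) (0 : ℂ)
    exact ((e1.mul_const M).mul e2).congr_deriv (by simp [sub_eq_add_neg])
  have h2 : HasFDerivAt φ (fderiv ℂ φ M) M := hφ.differentiableAt.hasFDerivAt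
  have h3 := h2.comp_hasDerivAt_of_eq 0 h1 (by simp)
  have h4 : (φ ∘ fun t : ℂ => NormedSpace.exp (t • X) * M * NormedSpace.exp (t • (-X))) =
      fun _ => φ M := by
    funext t
    have hc : Commute (t • X) (t • (-X)) := by
      rw [smul_neg]
      exact (Commute.refl (t • X)).neg_right
    have e1 : NormedSpace.exp (t • X) * NormedSpace.exp (t • (-X)) = 1 := by
      rw [← Matrix.exp_add_of_commute _ _ hc, ← smul_add, add_neg_cancel, smul_zero,
        NormedSpace.exp_zero]
    have e2 : NormedSpace.exp (t • (-X)) * NormedSpace.exp (t • X) = 1 := by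
      rw [← Matrix.exp_add_of_commute _ _ hc.symm, ← smul_add, neg_add_cancel, smul_zero,
        NormedSpace.exp_zero]
    exact hconj ⟨_, _, e1, e2⟩ M
  rw [h4] at h3
  exact h3.unique (hasDerivAt_const 0 (φ M))

/-- An `r`-matrix relation at `(lam, mu, x)` makes invariant functions of `L(lam)` and `L(mu)`
commute at `x`. -/
theorem bracket_eq_zero_of_rMatrix {p : ℕ} {n : Type} [Fintype n] [DecidableEq n]
    {L : CotSO p → ℂ → Matrix n n ℂ} {lam mu : ℂ}
    {x : CotSO p} {dF dL dF' dL' : LieAlgebra.Orthogonal.so (Fin p) ℝ → Matrix n n ℂ}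
    (h : HasVelocity (fun z => L z lam) x dF dL) (h' : HasVelocity (fun z => L z mu) x dF' dL')
    {φ ψ : Matrix n n ℂ → ℂ} (hφ : Differentiable ℂ φ) (hψ : Differentiable ℂ ψ)
    (hφc : ∀ (U : (Matrix n n ℂ)ˣ) (M : Matrix n n ℂ), φ (U * M * (U⁻¹ : (Matrix n n ℂ)ˣ)) = φ M)
    (hψc : ∀ (U : (Matrix n n ℂ)ˣ) (M : Matrix n n ℂ), ψ (U * M * (U⁻¹ : (Matrix n n ℂ)ˣ)) = ψ M)
    {r r' : Matrix (n × n) (n × n) ℂ}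
    (hr : -tensorBracket L lam mu x =
      ⁅r, L x lam ⊗ₖ (1 : Matrix n n ℂ)⁆ - ⁅r', (1 : Matrix n n ℂ) ⊗ₖ L x mu⁆) :
    bracket (fun z => φ (L z lam)) (fun z => ψ (L z mu)) x = 0 := by
  rw [bracket_comp h h' hφ hψ, ← neg_eq_zero, ← map_neg, hr, map_sub,
    kronFunctional_commutator_left _ _ _ (fun X => fderiv_commutator_eq_zero hφ hφc _ X),
    kronFunctional_commutator_right _ _ _ (fun X => fderiv_commutator_eq_zero hψ hψc _ X), sub_zero]

theorem contDiff_trace_pow {n : Type} [Fintype n] [DecidableEq n] (i : ℕ) :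
    ContDiff ℂ 1 (fun M : Matrix n n ℂ => (M ^ i).trace) := by
  have h : ContDiff ℂ 1 (fun M : Matrix n n ℂ => M ^ i) := contDiff_id.pow i
  exact (Matrix.traceLinearMap n ℂ ℂ).toContinuousLinearMap.contDiff.comp h

theorem contDiff_mvPolynomial_eval {n : Type} [Fintype n] [DecidableEq n]
    (P : MvPolynomial (n × n) ℂ) :
    ContDiff ℂ 1 (fun M : Matrix n n ℂ => MvPolynomial.eval (fun a => M a.1 a.2) P) := by
  induction P using MvPolynomial.induction_on with
  | C t => simpa using contDiff_const
  | add P Q hP hQ => simpa using hP.add hQ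
  | mul_X P a hP =>
    have h : ContDiff ℂ 1 (fun M : Matrix n n ℂ => M a.1 a.2) :=
      (Matrix.entryLinearMap ℂ ℂ a.1 a.2).toContinuousLinearMap.contDiff
    simpa using hP.mul h

/-- The coefficient is a fixed polynomial in the matrix entries, read off from the universal
characteristic polynomial. -/
theorem contDiff_charpoly_coeff {n : Type} [Fintype n] [DecidableEq n] (i : ℕ) :
    ContDiff ℂ 1 (fun M : Matrix n n ℂ => M.charpoly.coeff i) := by
  have h := contDiff_mvPolynomial_eval ((Matrix.charpoly.univ ℂ n).coeff i)
  convert h using 2 with M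
  have := Matrix.charpoly.univ_coeff_eval₂Hom n (RingHom.id ℂ) (fun a : n × n => M a.1 a.2) i
  rw [MvPolynomial.eval, this]
  rfl

/-- Involutivity of invariant functions away from `lam ^ 2 = mu ^ 2` extends by continuity. -/
theorem bracket_eq_zero_of_eventually {p : ℕ} {n : Type} [Fintype n] [DecidableEq n]
    {L : CotSO p → ℂ → Matrix n n ℂ} {D : Set ℂ} {lam mu : ℂ} {x : CotSO p}
    {dF dL : ℂ → LieAlgebra.Orthogonal.so (Fin p) ℝ → Matrix n n ℂ}
    (h : ∀ nu ∈ D, HasVelocity (fun z => L z nu) x (dF nu) (dL nu))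
    (hlam : lam ∈ D) (hmu : mu ∈ D) (hD : ∀ᶠ nu in nhds mu, nu ∈ D)
    (hL : ContinuousAt (fun nu => L x nu) mu) (hdF : ∀ X, ContinuousAt (fun nu => dF nu X) mu)
    (hdL : ∀ X, ContinuousAt (fun nu => dL nu X) mu)
    {φ ψ : Matrix n n ℂ → ℂ} (hφ : ContDiff ℂ 1 φ) (hψ : ContDiff ℂ 1 ψ)
    (h0 : ∀ nu ∈ D, lam ^ 2 ≠ nu ^ 2 →
      bracket (fun z => φ (L z lam)) (fun z => ψ (L z nu)) x = 0) :
    bracket (fun z => φ (L z lam)) (fun z => ψ (L z mu)) x = 0 := by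
  -- `g` is the bracket written through the velocities; continuity in `nu` is visible in this form,
  -- and no `r`-matrix enters.
  set g : ℂ → ℂ := fun nu => kronFunctional (fderiv ℂ φ (L x lam)).toLinearMap
    (fderiv ℂ ψ (L x nu)).toLinearMap (pairing x (dF lam) (dL lam) (dF nu) (dL nu)) with hg
  have key : ∀ nu ∈ D, bracket (fun z => φ (L z lam)) (fun z => ψ (L z nu)) x = g nu := by
    intro nu hnu
    rw [bracket_comp (h lam hlam) (h nu hnu) (hφ.differentiable (by simp))
      (hψ.differentiable (by simp)), tensorBracket_eq_pairing (h lam hlam) (h nu hnu)]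
  have hdψ : ContinuousAt (fun nu => fderiv ℂ ψ (L x nu)) mu :=
    ContinuousAt.comp (f := fun nu => L x nu) (hψ.continuous_fderiv (by simp)).continuousAt hL
  have hcont : ContinuousAt g mu := by
    simp only [hg, kronFunctional_pairing, ContinuousLinearMap.coe_coe]
    fun_prop
  rw [key mu hmu]
  have hne : ∀ᶠ nu in nhdsWithin mu {mu}ᶜ, lam ^ 2 ≠ nu ^ 2 := by
    -- Even if `mu = ±lam`, a small punctured neighbourhood of `mu` avoids both `lam` and `-lam`.
    have hfin : (({lam, -lam} : Set ℂ) \ {mu}).Finite := (Set.toFinite _).sdiff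
    have h1 : ∀ᶠ nu in nhds mu, nu ∉ ({lam, -lam} : Set ℂ) \ {mu} :=
      hfin.isClosed.isOpen_compl.mem_nhds (by simp)
    filter_upwards [h1.filter_mono nhdsWithin_le_nhds, self_mem_nhdsWithin] with nu h2 h3 h4
    refine h2 ⟨?_, h3⟩
    rcases sq_eq_sq_iff_eq_or_eq_neg.1 h4 with h5 | h5 <;> simp [h5]
  have hz : ∀ᶠ nu in nhdsWithin mu {mu}ᶜ, g nu = 0 := by
    filter_upwards [hne, hD.filter_mono nhdsWithin_le_nhds] with nu h1 h2
    rw [← key nu h2, h0 nu h2 h1]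
  refine tendsto_nhds_unique (l := nhdsWithin mu {mu}ᶜ) (hcont.tendsto.mono_left nhdsWithin_le_nhds) ?_
  exact tendsto_const_nhds.congr' (hz.mono fun _ h => h.symm)

end Spectral

/-! ### Brackets of the blocks of the reduced Lax matrix -/

/-- The derivative of `laxA` along the left-invariant field of `X`. -/
def aVel {p : ℕ} (q : ℕ) (x : CotSO p) (X : LieAlgebra.Orthogonal.so (Fin p) ℝ) :
    Matrix (Blk p q) (Blk p q) ℂ :=
  toC (Matrix.fromBlocks 0 (x.k * X.1 * truncId p q)
    (-((truncId p q).transpose * X.1 * x.k.transpose)) 0)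

/-- The derivative of the reduction of `laxL` in the direction `X` of the fibre. -/
def lFibreVel {p : ℕ} (q : ℕ) (x : CotSO p) (X : LieAlgebra.Orthogonal.so (Fin p) ℝ) :
    Matrix (Blk p q) (Blk p q) ℂ :=
  -toC (Matrix.fromBlocks (x.k * X.1 * x.k.transpose) 0 0
    (-((truncId p q).transpose * X.1 * truncId p q)))

/-- The derivative of the reduction of `laxL` along the left-invariant field of `X`. -/
def lLeftVel {p : ℕ} (q : ℕ) (x : CotSO p) (X : LieAlgebra.Orthogonal.so (Fin p) ℝ) :
    Matrix (Blk p q) (Blk p q) ℂ :=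
  -toC (Matrix.fromBlocks (x.k * X.1 * (x.l * x.k.transpose) - x.k * x.l * X.1 * x.k.transpose) 0 0
    (0 : Matrix (Fin q) (Fin q) ℝ))

theorem CotSO.k_mul_transpose {p : ℕ} (x : CotSO p) : x.k * x.k.transpose = 1 :=
  (Matrix.mem_orthogonalGroup_iff _ _).1 (Matrix.mem_specialOrthogonalGroup_iff.1 x.1.2).1

theorem CotSO.transpose_l {p : ℕ} (x : CotSO p) : x.l.transpose = -x.l :=
  (LieAlgebra.Orthogonal.mem_so _ _ x.2.1).1 x.2.2

theorem laxA_kowPoint {p q : ℕ} (x : CotSO p) :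
    laxA (truncId p q) x (kowPoint q x) = toC (Matrix.fromBlocks 0 (x.k * truncId p q)
      ((truncId p q).transpose * x.k.transpose) 0) := by
  have h : (kowPoint q x).k = 1 := rfl
  simp [laxA, h]

theorem laxL_kowPoint {p q : ℕ} (x : CotSO p) :
    laxL x (kowPoint q x) = -toC (Matrix.fromBlocks (x.k * x.l * x.k.transpose) 0 0
      (-((truncId p q).transpose * x.l * truncId p q))) := by
  have h : (kowPoint q x).k = 1 := rfl
  have h' : (kowPoint q x).l = -((truncId p q).transpose * x.l * truncId p q) := rfl
  simp [laxL, h, h']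

/-- This is `{l₁, a₂} = [1 ⊗ a, P_f]`: `a` has no fibre derivative, so only one term of the bracket
survives. The Casimir identity `sum_gen_gen` evaluates it, with `k kᵀ = 1` and `Eᵀ E = 1` producing
the deltas of `P_f`. -/
theorem sum_lFibreVel_kronecker_aVel {p q : ℕ} (hqp : q ≤ p) (x : CotSO p) :
    ∑ i, ∑ j ∈ Finset.Ioi i, lFibreVel q x (gen i j) ⊗ₖ aVel q x (gen i j) =
      (1 ⊗ₖ laxA (truncId p q) x (kowPoint q x)) * casimirF p q * (1 ⊗ₖ 1)
        - (1 ⊗ₖ 1) * casimirF p q * (1 ⊗ₖ laxA (truncId p q) x (kowPoint q x)) := by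
  have hE := truncId_transpose_mul hqp
  have hk := x.k_mul_transpose
  ext ⟨a, b⟩ ⟨c, d⟩
  rw [Matrix.sub_apply, casimirF_eq, kernel_sandwich_right, kernel_sandwich_right, laxA_kowPoint]
  simp only [Matrix.sum_apply, Matrix.kronecker_apply]
  rcases a with a | a <;> rcases b with b | b <;> rcases c with c | c <;> rcases d with d | d <;>
    simp [lFibreVel, aVel, toC, -Complex.ofReal_mul, sum_gen_gen, hE, hk]
  all_goals
    simp only [← Matrix.transpose_mul, Matrix.transpose_apply, Matrix.one_apply, Complex.ofReal_mul]
    split_ifs <;> first | (simp; done) | (exfalso; grind)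

theorem sum_aVel_kronecker_lFibreVel {p q : ℕ} (hqp : q ≤ p) (x : CotSO p) :
    ∑ i, ∑ j ∈ Finset.Ioi i, aVel q x (gen i j) ⊗ₖ lFibreVel q x (gen i j) =
      (laxA (truncId p q) x (kowPoint q x) ⊗ₖ 1) * casimirF p q * (1 ⊗ₖ 1)
        - (1 ⊗ₖ 1) * casimirF p q * (laxA (truncId p q) x (kowPoint q x) ⊗ₖ 1) := by
  have hE := truncId_transpose_mul hqp
  have hk := x.k_mul_transpose
  ext ⟨a, b⟩ ⟨c, d⟩
  rw [Matrix.sub_apply, casimirF_eq, kernel_sandwich_left, kernel_sandwich_left, laxA_kowPoint]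
  simp only [Matrix.sum_apply, Matrix.kronecker_apply]
  rcases a with a | a <;> rcases b with b | b <;> rcases c with c | c <;> rcases d with d | d <;>
    simp [lFibreVel, aVel, toC, -Complex.ofReal_mul, sum_gen_gen, hE, hk]
  all_goals
    simp only [← Matrix.transpose_mul, Matrix.transpose_apply, Matrix.one_apply, Complex.ofReal_mul]
    split_ifs <;> first | (simp; done) | (exfalso; grind)

/-- This is `{l₁, l₂} = [P_f, l ⊗ 1]`. In the mixed blocks the derivative of `kℓkᵀ` along `k`
cancels the Lie–Poisson term of `ℓ`, so the `so(p)` and `so(q)` momenta commute. -/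
theorem pairing_lVel {p q : ℕ} (hqp : q ≤ p) (x : CotSO p) :
    pairing x (lFibreVel q x) (lLeftVel q x) (lFibreVel q x) (lLeftVel q x) =
      (1 ⊗ₖ 1) * casimirF p q * (laxL x (kowPoint q x) ⊗ₖ 1)
        - (laxL x (kowPoint q x) ⊗ₖ 1) * casimirF p q * (1 ⊗ₖ 1) := by
  have hE := truncId_transpose_mul hqp
  have hk := x.k_mul_transpose
  have hl := x.transpose_l
  have hU : ∀ a b, (x.k * x.l * x.k.transpose) b a = -(x.k * x.l * x.k.transpose) a b := by
    intro a b
    rw [← Matrix.transpose_apply (x.k * x.l * x.k.transpose)]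
    simp only [Matrix.transpose_mul, Matrix.transpose_transpose, hl, Matrix.mul_assoc,
      Matrix.neg_mul, Matrix.mul_neg, Matrix.neg_apply]
  have hV : ∀ a b, ((truncId p q).transpose * x.l * truncId p q) b a =
      -((truncId p q).transpose * x.l * truncId p q) a b := by
    intro a b
    rw [← Matrix.transpose_apply ((truncId p q).transpose * x.l * truncId p q)]
    simp only [Matrix.transpose_mul, Matrix.transpose_transpose, hl, Matrix.mul_assoc,
      Matrix.neg_mul, Matrix.mul_neg, Matrix.neg_apply]
  have hW : ∀ a b, ((truncId p q).transpose * x.l * x.k.transpose) b a =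
      -(x.k * x.l * truncId p q) a b := by
    intro a b
    rw [← Matrix.transpose_apply ((truncId p q).transpose * x.l * x.k.transpose)]
    simp only [Matrix.transpose_mul, Matrix.transpose_transpose, hl, Matrix.mul_assoc,
      Matrix.neg_mul, Matrix.mul_neg, Matrix.neg_apply]
  have hA : ∀ a b, ((truncId p q).transpose * x.k.transpose) b a = (x.k * truncId p q) a b := by
    intro a b
    rw [← Matrix.transpose_mul, Matrix.transpose_apply]
  have hI : ∀ a b, (1 : Matrix (Blk p q) (Blk p q) ℂ) (Sum.inl a) (Sum.inl b) =
      ((1 : Matrix (Fin p) (Fin p) ℝ) a b : ℂ) := by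
    intro a b
    simp [Matrix.one_apply, apply_ite Complex.ofReal]
  have hI' : ∀ a b, (1 : Matrix (Blk p q) (Blk p q) ℂ) (Sum.inr a) (Sum.inr b) =
      ((1 : Matrix (Fin q) (Fin q) ℝ) a b : ℂ) := by
    intro a b
    simp [Matrix.one_apply, apply_ite Complex.ofReal]
  have hS : ∀ {n : ℕ} (a b : Fin n),
      (1 : Matrix (Fin n) (Fin n) ℝ) b a = (1 : Matrix (Fin n) (Fin n) ℝ) a b := fun a b => by
    simp [Matrix.one_apply, eq_comm]
  ext ⟨a, b⟩ ⟨c, d⟩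
  rw [Matrix.sub_apply, casimirF_eq, kernel_sandwich_left, kernel_sandwich_left, laxL_kowPoint]
  simp only [pairing, Matrix.add_apply, Matrix.sub_apply, Matrix.smul_apply, Matrix.sum_apply,
    Matrix.kronecker_apply]
  rcases a with a | a <;> rcases b with b | b <;> rcases c with c | c <;> rcases d with d | d <;>
    simp [lFibreVel, lLeftVel, toC, -Complex.ofReal_mul, sum_gen_gen, sum_gen_gen_structFun, 
      Finset.sum_add_distrib, Matrix.transpose_mul, hE, hk, hl,
      sub_eq_add_neg, mul_add, add_mul]
  all_goals
    try simp only [← Matrix.mul_assoc]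
    push_cast
  · simp only [hI, hU c d, hU b c, hS c d]
    push_cast
    ring
  · simp only [hA c b, hW c b]
    push_cast
    ring
  · simp only [hA b a, hA d c, hA d a, hW b a, hW d a, hW d c, hW b c]
    push_cast
    ring
  · simp only [hI', hV c d, hV b c, hS c d]
    push_cast
    ring

/-! ### The `r`-matrix identity -/

theorem mul_sandwich_left {n : Type} [Fintype n] [DecidableEq n] (Z Y X : Matrix n n ℂ)
    (T : Matrix (n × n) (n × n) ℂ) :
    (Z ⊗ₖ (1 : Matrix n n ℂ)) * ((Y ⊗ₖ (1 : Matrix n n ℂ)) * T * (X ⊗ₖ (1 : Matrix n n ℂ))) =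
      ((Z * Y) ⊗ₖ (1 : Matrix n n ℂ)) * T * (X ⊗ₖ (1 : Matrix n n ℂ)) := by
  rw [← mul_assoc, ← mul_assoc, ← Matrix.mul_kronecker_mul, one_mul]

theorem sandwich_left_mul {n : Type} [Fintype n] [DecidableEq n] (Z Y X : Matrix n n ℂ)
    (T : Matrix (n × n) (n × n) ℂ) :
    ((Y ⊗ₖ (1 : Matrix n n ℂ)) * T * (X ⊗ₖ (1 : Matrix n n ℂ))) * (Z ⊗ₖ (1 : Matrix n n ℂ)) =
      (Y ⊗ₖ (1 : Matrix n n ℂ)) * T * ((X * Z) ⊗ₖ (1 : Matrix n n ℂ)) := by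
  rw [mul_assoc _ (X ⊗ₖ _), ← Matrix.mul_kronecker_mul, one_mul]

theorem mul_sandwich_right {n : Type} [Fintype n] [DecidableEq n] (Z Y X : Matrix n n ℂ)
    (T : Matrix (n × n) (n × n) ℂ) :
    ((1 : Matrix n n ℂ) ⊗ₖ Z) * (((1 : Matrix n n ℂ) ⊗ₖ Y) * T * ((1 : Matrix n n ℂ) ⊗ₖ X)) =
      ((1 : Matrix n n ℂ) ⊗ₖ (Z * Y)) * T * ((1 : Matrix n n ℂ) ⊗ₖ X) := by
  rw [← mul_assoc, ← mul_assoc, ← Matrix.mul_kronecker_mul, one_mul]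

theorem sandwich_right_mul {n : Type} [Fintype n] [DecidableEq n] (Z Y X : Matrix n n ℂ)
    (T : Matrix (n × n) (n × n) ℂ) :
    (((1 : Matrix n n ℂ) ⊗ₖ Y) * T * ((1 : Matrix n n ℂ) ⊗ₖ X)) * ((1 : Matrix n n ℂ) ⊗ₖ Z) =
      ((1 : Matrix n n ℂ) ⊗ₖ Y) * T * ((1 : Matrix n n ℂ) ⊗ₖ (X * Z)) := by
  rw [mul_assoc _ (_ ⊗ₖ X), ← Matrix.mul_kronecker_mul, one_mul]

/-- The map `A ↦ λ A - (y A + A y) / 2`. -/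
def shear {n : Type} [Fintype n] (y : Matrix n n ℂ) (lam : ℂ) (A : Matrix n n ℂ) : Matrix n n ℂ :=
  lam • A - (1 / 2 : ℂ) • (y * A + A * y)

/-- The relation for the numerators, with `R`, `S`, `S'` standing for the brackets of `l` and `a`.
The correction `(ya + ay)/2` is block diagonal and antisymmetric, like `l`; the terms quadratic in
`F` cancel because `y` and `s` are built from the same `F`. -/
theorem rMatrix_identity {p q : ℕ} (A F : Matrix (Fin p) (Fin q) ℂ) (U : Matrix (Fin p) (Fin p) ℂ)
    (V : Matrix (Fin q) (Fin q) ℂ) (hU : ∀ i j, U j i = -U i j) (hV : ∀ i j, V j i = -V i j)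
    (c lam mu : ℂ) (hlam : lam ≠ 0) (hmu : mu ≠ 0) (hne : lam ^ 2 ≠ mu ^ 2)
    (a y l s N N' H H' : Matrix (Blk p q) (Blk p q) ℂ)
    (ha : a = Matrix.fromBlocks 0 A A.transpose 0)
    (hy : y = c • Matrix.fromBlocks 0 F (-F.transpose) 0)
    (hl : l = Matrix.fromBlocks U 0 0 V)
    (hs : s = Matrix.fromBlocks 0 F F.transpose 0)
    (hN : N = shear y lam a + l + lam⁻¹ • s) (hN' : N' = shear y mu a + l + mu⁻¹ • s)
    (hH : H = 1 - lam⁻¹ • y) (hH' : H' = 1 - mu⁻¹ • y)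
    (S S' R : Matrix (Blk p q × Blk p q) (Blk p q × Blk p q) ℂ)
    (hS : S = (1 ⊗ₖ a) * casimirF p q * (1 ⊗ₖ 1) - (1 ⊗ₖ 1) * casimirF p q * (1 ⊗ₖ a))
    (hS' : S' = (a ⊗ₖ 1) * casimirF p q * (1 ⊗ₖ 1) - (1 ⊗ₖ 1) * casimirF p q * (a ⊗ₖ 1))
    (hR : R = (1 ⊗ₖ 1) * casimirF p q * (l ⊗ₖ 1) - (l ⊗ₖ 1) * casimirF p q * (1 ⊗ₖ 1)) :
    -(R + (mu • S - (1 / 2 : ℂ) • ((1 ⊗ₖ y) * S + S * (1 ⊗ₖ y)))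
        - (lam • S' - (1 / 2 : ℂ) • ((y ⊗ₖ 1) * S' + S' * (y ⊗ₖ 1)))) =
      (H ⊗ₖ 1) * rKernel p q lam mu * (N ⊗ₖ 1) - (N ⊗ₖ 1) * rKernel p q lam mu * (H ⊗ₖ 1)
        - ((1 ⊗ₖ H') * rKernel p q mu lam * (1 ⊗ₖ N')
          - (1 ⊗ₖ N') * rKernel p q mu lam * (1 ⊗ₖ H')) := by
  -- Naming the two products makes the blocks of `ya` and `ay` atoms, so no matrix product is left
  -- inside an entry.
  set B := F * A.transpose with hB
  set C := F.transpose * A with hC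
  have hya : y * a = c • Matrix.fromBlocks B 0 0 (-C) := by
    rw [hy, ha, Matrix.smul_mul, Matrix.fromBlocks_multiply]
    simp [hB, hC]
  have hay : a * y = c • Matrix.fromBlocks (-B.transpose) 0 0 C.transpose := by
    rw [hy, ha, Matrix.mul_smul, Matrix.fromBlocks_multiply]
    simp [hB, hC]
  have h1 : lam ^ 2 - mu ^ 2 ≠ 0 := sub_ne_zero.2 hne
  have h3 : (mu ^ 2 - lam ^ 2)⁻¹ = -(lam ^ 2 - mu ^ 2)⁻¹ := by
    rw [← inv_neg, neg_sub]
  rw [hS, hS', hR]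
  simp only [mul_sub, sub_mul, mul_sandwich_left, mul_sandwich_right, sandwich_left_mul,
    sandwich_right_mul, mul_one, one_mul, casimirF_eq, rKernel_eq]
  ext ⟨i, j⟩ ⟨k, m⟩
  simp only [Matrix.add_apply, Matrix.sub_apply, Matrix.neg_apply, Matrix.smul_apply,
    kernel_sandwich_left, kernel_sandwich_right, smul_eq_mul, hN, hN', hH, hH', shear, hya, hay]
  -- Symmetry of `1` and antisymmetry of `l` bring equal entries to one form, which `ring` cannot
  -- do.
  have hone : ∀ a b, (1 : Matrix (Blk p q) (Blk p q) ℂ) b a = (1 : Matrix _ _ ℂ) a b := fun a b => by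
    simp only [Matrix.one_apply, eq_comm]
  have hl' : ∀ a b, l b a = -l a b := by
    rintro (a | a) (b | b)
    · simpa [hl] using hU a b
    · simp [hl]
    · simp [hl]
    · simpa [hl] using hV a b
  simp only [hone i j, hone k m, hl' i j, hl' k m]
  simp only [ha, hy, hl, hs, Matrix.smul_apply, smul_eq_mul]
  rcases i with i | i <;> rcases j with j | j <;> rcases k with k | k <;> rcases m with m | m <;>
    simp [div_eq_mul_inv, h3]
  all_goals
    field_simp
    ring

/-! ### The derivatives of the reduced Lax matrix -/

theorem hasDerivAt_mul_apply {m n r : Type} [Fintype n] {M : ℝ → Matrix m n ℝ} {M' : Matrix m n ℝ}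
    {N : ℝ → Matrix n r ℝ} {N' : Matrix n r ℝ} {t : ℝ}
    (hM : ∀ a b, HasDerivAt (fun s => M s a b) (M' a b) t)
    (hN : ∀ a b, HasDerivAt (fun s => N s a b) (N' a b) t) (a : m) (c : r) :
    HasDerivAt (fun s => (M s * N s) a c) ((M' * N t + M t * N') a c) t := by
  have h := HasDerivAt.fun_sum (u := Finset.univ) fun b _ => (hM a b).mul (hN b c)
  simpa [Matrix.mul_apply, Finset.sum_add_distrib] using h

theorem hasDerivAt_const_apply {m n : Type} (M : Matrix m n ℝ) (t : ℝ) (a : m) (b : n) :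
    HasDerivAt (fun _ : ℝ => M a b) ((0 : Matrix m n ℝ) a b) t := hasDerivAt_const t (M a b)

section Velocity

variable {p : ℕ} (q : ℕ) (x : CotSO p) (X : LieAlgebra.Orthogonal.so (Fin p) ℝ)

theorem expSO_zero : expSO (0 : LieAlgebra.Orthogonal.so (Fin p) ℝ) = 1 := by
  ext a b
  simp [expSO]

theorem hasDerivAt_laxA_left (a b : Blk p q) :
    HasDerivAt (fun t : ℝ => laxA (truncId p q) (x.1 * expSO (t • X), x.2)
      (kowPoint q (x.1 * expSO (t • X), x.2)) a b) (aVel q x X a b) 0 := by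
  simp only [laxA_kowPoint]
  have hk : ∀ a b, HasDerivAt (fun t : ℝ => CotSO.k (x.1 * expSO (t • X), x.2) a b)
      ((x.k * X.1) a b) 0 := hasDerivAt_mul_exp_apply x.k X.1
  have hX : X.1.transpose = -X.1 := (LieAlgebra.Orthogonal.mem_so _ _ X.1).1 X.2
  have hkE := hasDerivAt_mul_apply hk (hasDerivAt_const_apply (truncId p q) 0)
  have hEk : ∀ a b, HasDerivAt (fun t : ℝ => ((truncId p q).transpose *
      (CotSO.k (x.1 * expSO (t • X), x.2)).transpose) a b)
      (-((truncId p q).transpose * X.1 * x.k.transpose) a b) 0 := by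
    intro a b
    refine (hasDerivAt_mul_apply (hasDerivAt_const_apply (truncId p q).transpose 0)
      (N := fun t => (CotSO.k (x.1 * expSO (t • X), x.2)).transpose) (N' := (x.k * X.1).transpose) (fun i j => hk j i) a b).congr_deriv ?_
    simp [hX, Matrix.mul_assoc, Matrix.transpose_mul]
  rcases a with a | a <;> rcases b with b | b
  · simpa [toC, aVel] using hasDerivAt_const (0 : ℝ) (0 : ℂ)
  · refine ((hkE a b).ofReal_comp).congr_deriv ?_
    simp [toC, aVel]
  · refine ((hEk a b).ofReal_comp).congr_deriv ?_
    simp [toC, aVel]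
  · simpa [toC, aVel] using hasDerivAt_const (0 : ℝ) (0 : ℂ)

theorem hasDerivAt_laxL_left (a b : Blk p q) :
    HasDerivAt (fun t : ℝ => laxL (x.1 * expSO (t • X), x.2)
      (kowPoint q (x.1 * expSO (t • X), x.2)) a b) (lLeftVel q x X a b) 0 := by
  simp only [laxL_kowPoint]
  have hk : ∀ a b, HasDerivAt (fun t : ℝ => CotSO.k (x.1 * expSO (t • X), x.2) a b)
      ((x.k * X.1) a b) 0 := hasDerivAt_mul_exp_apply x.k X.1
  have hk0 : CotSO.k (x.1 * expSO ((0 : ℝ) • X), x.2) = x.k := by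
    rw [zero_smul, expSO_zero, mul_one]
  have hX : X.1.transpose = -X.1 := (LieAlgebra.Orthogonal.mem_so _ _ X.1).1 X.2
  have h1 := hasDerivAt_mul_apply hk (hasDerivAt_const_apply x.l 0)
  have h2 := hasDerivAt_mul_apply h1
    (N := fun t => (CotSO.k (x.1 * expSO (t • X), x.2)).transpose)
    (N' := (x.k * X.1).transpose) (fun i j => hk j i)
  rcases a with a | a <;> rcases b with b | b
  · refine ((h2 a b).neg.ofReal_comp).congr_deriv ?_ |>.congr_of_eventuallyEq ?_
    · rw [hk0]
      simp [toC, lLeftVel, hX, Matrix.mul_assoc, Matrix.transpose_mul, sub_eq_add_neg]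
    · exact Filter.Eventually.of_forall fun t => by simp [toC]; rfl
  · simpa [toC, lLeftVel] using hasDerivAt_const (0 : ℝ) (0 : ℂ)
  · simpa [toC, lLeftVel] using hasDerivAt_const (0 : ℝ) (0 : ℂ)
  · simpa [toC, lLeftVel, CotSO.l] using hasDerivAt_const (0 : ℝ) _

theorem hasDerivAt_laxL_fibre (a b : Blk p q) :
    HasDerivAt (fun t : ℝ => laxL (x.1, x.2 + t • X) (kowPoint q (x.1, x.2 + t • X)) a b)
      (lFibreVel q x X a b) 0 := by
  simp only [laxL_kowPoint]
  have hl : ∀ a b, HasDerivAt (fun t : ℝ => CotSO.l (x.1, x.2 + t • X) a b) (X.1 a b) 0 := by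
    intro a b
    have h : HasDerivAt (fun t : ℝ => x.2.1 a b + t * X.1 a b) (X.1 a b) 0 := by
      simpa using ((hasDerivAt_id (0 : ℝ)).mul_const (X.1 a b)).const_add (x.2.1 a b)
    exact h
  have h1 := hasDerivAt_mul_apply (hasDerivAt_mul_apply (hasDerivAt_const_apply x.k 0) hl)
    (hasDerivAt_const_apply x.k.transpose 0)
  have h2 := hasDerivAt_mul_apply
    (hasDerivAt_mul_apply (hasDerivAt_const_apply (truncId p q).transpose 0) hl)
    (hasDerivAt_const_apply (truncId p q) 0)
  rcases a with a | a <;> rcases b with b | b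
  · refine ((h1 a b).neg.ofReal_comp).congr_deriv ?_ |>.congr_of_eventuallyEq ?_
    · simp [toC, lFibreVel]
    · exact Filter.Eventually.of_forall fun t => by simp [toC]; rfl
  · simpa [toC, lFibreVel] using hasDerivAt_const (0 : ℝ) (0 : ℂ)
  · simpa [toC, lFibreVel] using hasDerivAt_const (0 : ℝ) (0 : ℂ)
  · refine ((h2 a b).ofReal_comp).congr_deriv ?_ |>.congr_of_eventuallyEq ?_
    · simp [toC, lFibreVel]
    · exact Filter.Eventually.of_forall fun t => by simp [toC]

-- The fibre direction moves only `l`, since `a` depends on `k` alone; the left-invariant direction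
-- moves both. The factor `(1 - λ⁻¹y)⁻¹` is constant.
open scoped Matrix.Norms.Operator in
theorem hasVelocity_laxYKow (F : Matrix (Fin p) (Fin q) ℝ) (c lam : ℂ) :
    HasVelocity (fun z => laxYKow F c z lam) x
      (fun X => (1 - lam⁻¹ • yMat F c)⁻¹ * lFibreVel q x X)
      (fun X => (1 - lam⁻¹ • yMat F c)⁻¹ * (shear (yMat F c) lam (aVel q x X)
        + lLeftVel q x X)) := by
  constructor
  · intro X
    refine hasDerivAt_matrix.1 ?_
    have hl := hasDerivAt_matrix.2 (hasDerivAt_laxL_fibre q x X)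
    refine (((hl.sub_const ((1 / 2 : ℂ) • (yMat F c * laxA (truncId p q) x (kowPoint q x)
      + laxA (truncId p q) x (kowPoint q x) * yMat F c))).const_add
        (lam • laxA (truncId p q) x (kowPoint q x))).add_const (lam⁻¹ • laxS F)).const_mul _
  · intro X
    refine hasDerivAt_matrix.1 ?_
    have hl := hasDerivAt_matrix.2 (hasDerivAt_laxL_left q x X)
    have ha := hasDerivAt_matrix.2 (hasDerivAt_laxA_left q x X)
    refine ((((ha.const_smul lam).add (hl.sub (((ha.const_mul (yMat F c)).add
      (ha.mul_const (yMat F c))).const_smul (1 / 2 : ℂ)))).add_const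
        (lam⁻¹ • laxS F)).const_mul ((1 - lam⁻¹ • yMat F c)⁻¹)).congr_deriv ?_
    rw [shear]
    congr 1
    abel

end Velocity

/-! ### The `r`-matrix relation -/

theorem kronecker_shear {n : Type} [Fintype n] [DecidableEq n] (y A B : Matrix n n ℂ) (mu : ℂ) :
    B ⊗ₖ shear y mu A = mu • (B ⊗ₖ A)
      - (1 / 2 : ℂ) • ((1 ⊗ₖ y) * (B ⊗ₖ A) + (B ⊗ₖ A) * (1 ⊗ₖ y)) := by
  rw [← Matrix.mul_kronecker_mul, ← Matrix.mul_kronecker_mul, one_mul, mul_one]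
  ext ⟨a, b⟩ ⟨c, d⟩
  simp [shear]
  ring

theorem shear_kronecker {n : Type} [Fintype n] [DecidableEq n] (y A B : Matrix n n ℂ) (lam : ℂ) :
    shear y lam A ⊗ₖ B = lam • (A ⊗ₖ B)
      - (1 / 2 : ℂ) • ((y ⊗ₖ 1) * (A ⊗ₖ B) + (A ⊗ₖ B) * (y ⊗ₖ 1)) := by
  rw [← Matrix.mul_kronecker_mul, ← Matrix.mul_kronecker_mul, one_mul, mul_one]
  ext ⟨a, b⟩ ⟨c, d⟩
  simp [shear]
  ring

/-- Bilinear expansion of `{N₁, N'₂}`: `B` and `D` are the velocities of `l`, `A` that of `a`. No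
`A`–`A` term occurs because `a` has no fibre velocity. -/
theorem pairing_shear {p : ℕ} {n : Type} [Fintype n] [DecidableEq n] (x : CotSO p)
    (y : Matrix n n ℂ) (lam mu : ℂ)
    (A B D : LieAlgebra.Orthogonal.so (Fin p) ℝ → Matrix n n ℂ) (S S' : Matrix (n × n) (n × n) ℂ)
    (hS : ∑ i, ∑ j ∈ Finset.Ioi i, B (gen i j) ⊗ₖ A (gen i j) = S)
    (hS' : ∑ i, ∑ j ∈ Finset.Ioi i, A (gen i j) ⊗ₖ B (gen i j) = S') :
    pairing x B (fun X => shear y lam (A X) + D X) B (fun X => shear y mu (A X) + D X) =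
      pairing x B D B D + (mu • S - (1 / 2 : ℂ) • ((1 ⊗ₖ y) * S + S * (1 ⊗ₖ y)))
        - (lam • S' - (1 / 2 : ℂ) • ((y ⊗ₖ 1) * S' + S' * (y ⊗ₖ 1))) := by
  rw [← hS, ← hS']
  simp only [pairing, Matrix.kronecker_add, Matrix.add_kronecker, kronecker_shear, shear_kronecker,
    Finset.mul_sum, Finset.sum_mul, Finset.smul_sum, Finset.sum_add_distrib,
    Finset.sum_sub_distrib, smul_add]
  abel

theorem toC_transpose {m n : Type} (M : Matrix m n ℝ) : toC M.transpose = (toC M).transpose := rfl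

theorem toC_fromBlocks {p q : ℕ} (A : Matrix (Fin p) (Fin p) ℝ) (B : Matrix (Fin p) (Fin q) ℝ)
    (C : Matrix (Fin q) (Fin p) ℝ) (D : Matrix (Fin q) (Fin q) ℝ) :
    toC (Matrix.fromBlocks A B C D) = Matrix.fromBlocks (toC A) (toC B) (toC C) (toC D) :=
  Matrix.fromBlocks_map A B C D _

theorem toC_neg {m n : Type} (M : Matrix m n ℝ) : toC (-M) = -toC M := by
  ext a b
  simp [toC]

theorem toC_zero {m n : Type} : toC (0 : Matrix m n ℝ) = 0 := by
  ext a b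
  simp [toC]

theorem permOp_rKernelY {p q : ℕ} (F : Matrix (Fin p) (Fin q) ℝ) (c lam mu : ℂ) :
    permOp (Blk p q) * rKernelY F c mu lam * permOp (Blk p q) =
      ((1 - lam⁻¹ • yMat F c)⁻¹ ⊗ₖ 1) * rKernel p q mu lam * (1 ⊗ₖ (1 - mu⁻¹ • yMat F c)) := by
  have h := permOp_kernel p q (-(mu ^ 2 / (mu ^ 2 - lam ^ 2))) (mu * lam / (mu ^ 2 - lam ^ 2))
  rw [← rKernel_eq] at h
  rw [rKernelY]
  conv_rhs => rw [← h]
  have e1 := permOp_mul_kronecker (1 : Matrix (Blk p q) (Blk p q) ℂ) (1 - lam⁻¹ • yMat F c)⁻¹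
  have e2 := permOp_mul_kronecker (1 : Matrix (Blk p q) (Blk p q) ℂ) (1 - mu⁻¹ • yMat F c)
  simp only [mul_assoc]
  rw [← e2, ← mul_assoc, e1]
  simp only [mul_assoc]

/-- With `ρ = G'₂ r H₁`, the relation `H G = 1` gives `ρ (GN)₁ = G'₂ r N₁`, and `G H = 1` gives `(G
⊗ G') H₁ r N₁ = G'₂ r N₁`; the remaining terms match likewise. -/
theorem kronecker_mul_dressing {n : Type} [Fintype n] [DecidableEq n]
    {G G' H H' : Matrix n n ℂ} (hGH : G * H = 1) (hGH' : G' * H' = 1) (N N' : Matrix n n ℂ)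
    (r r' : Matrix (n × n) (n × n) ℂ) :
    (G ⊗ₖ G') * ((H ⊗ₖ 1) * r * (N ⊗ₖ 1) - (N ⊗ₖ 1) * r * (H ⊗ₖ 1)
        - ((1 ⊗ₖ H') * r' * (1 ⊗ₖ N') - (1 ⊗ₖ N') * r' * (1 ⊗ₖ H'))) =
      ⁅(1 ⊗ₖ G') * r * (H ⊗ₖ 1), (G * N) ⊗ₖ (1 : Matrix n n ℂ)⁆
        - ⁅(G ⊗ₖ 1) * r' * (1 ⊗ₖ H'), (1 : Matrix n n ℂ) ⊗ₖ (G' * N')⁆ := by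
  have hHG : H * G = 1 := mul_eq_one_comm.1 hGH
  have hHG' : H' * G' = 1 := mul_eq_one_comm.1 hGH'
  have e1 : (H ⊗ₖ 1) * ((G * N) ⊗ₖ (1 : Matrix n n ℂ)) = N ⊗ₖ 1 := by
    rw [← Matrix.mul_kronecker_mul, ← mul_assoc, hHG, one_mul, one_mul]
  have e2 : (1 ⊗ₖ H') * ((1 : Matrix n n ℂ) ⊗ₖ (G' * N')) = 1 ⊗ₖ N' := by
    rw [← Matrix.mul_kronecker_mul, ← mul_assoc, hHG', one_mul, one_mul]
  rw [Ring.lie_def, Ring.lie_def, mul_assoc _ (H ⊗ₖ 1), e1, mul_assoc _ (1 ⊗ₖ H'), e2]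
  simp only [mul_sub, ← mul_assoc, ← Matrix.mul_kronecker_mul, hGH, hGH', mul_one, one_mul]

theorem satisfiesRMatrix_laxYKow {p q : ℕ} (hqp : q ≤ p) (F : Matrix (Fin p) (Fin q) ℝ) (c : ℂ) :
    SatisfiesRMatrix (laxYKow F c) (rKernelY F c) (domY F c) := by
  rintro lam ⟨hlam, hulam⟩ mu ⟨hmu, humu⟩ hne x
  have hl := x.transpose_l
  -- The lower diagonal block is `+EᵀℓE`: the sign of `m = -EᵀℓE` cancels the one in the definition
  -- of `l`.
  have key := rMatrix_identity (toC (x.k * truncId p q)) (toC F)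
    (-toC (x.k * x.l * x.k.transpose)) (toC ((truncId p q).transpose * x.l * truncId p q))
    (by
      intro i j
      rw [← Matrix.transpose_apply (-toC _), Matrix.transpose_neg, ← toC_transpose]
      simp only [Matrix.transpose_mul, Matrix.transpose_transpose, hl, Matrix.mul_assoc,
        Matrix.neg_mul, Matrix.mul_neg, toC_neg, Matrix.neg_apply])
    (by
      intro i j
      rw [← Matrix.transpose_apply (toC _), ← toC_transpose]
      simp only [Matrix.transpose_mul, Matrix.transpose_transpose, hl, Matrix.mul_assoc,
        Matrix.neg_mul, Matrix.mul_neg, toC_neg, Matrix.neg_apply])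
    c lam mu hlam hmu hne (laxA (truncId p q) x (kowPoint q x)) (yMat F c)
    (laxL x (kowPoint q x)) (laxS F) _ _ _ _
    (by rw [laxA_kowPoint, toC_fromBlocks, ← Matrix.transpose_mul, toC_transpose, toC_zero, toC_zero])
    (by rw [yMat, toC_fromBlocks, toC_neg, toC_transpose, toC_zero, toC_zero])
    (by
      rw [laxL_kowPoint, toC_fromBlocks, toC_neg, toC_zero, toC_zero, Matrix.fromBlocks_neg]
      simp)
    (by rw [laxS, toC_fromBlocks, toC_transpose, toC_zero, toC_zero])
    rfl rfl rfl rfl _ _ _ (sum_lFibreVel_kronecker_aVel hqp x)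
    (sum_aVel_kronecker_lFibreVel hqp x) (pairing_lVel hqp x)
  rw [tensorBracket_eq_pairing (hasVelocity_laxYKow q x F c lam) (hasVelocity_laxYKow q x F c mu),
    pairing_mul_left, pairing_shear x _ lam mu _ _ _ _ _ rfl rfl, ← mul_neg, key,
    permOp_rKernelY, rKernelY,
    kronecker_mul_dressing (Matrix.nonsing_inv_mul _ ((Matrix.isUnit_iff_isUnit_det _).1 hulam))
      (Matrix.nonsing_inv_mul _ ((Matrix.isUnit_iff_isUnit_det _).1 humu))]
  have hN : ∀ nu : ℂ, laxYKow F c x nu = (1 - nu⁻¹ • yMat F c)⁻¹ *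
      (shear (yMat F c) nu (laxA (truncId p q) x (kowPoint q x)) + laxL x (kowPoint q x)
        + nu⁻¹ • laxS F) := by
    intro nu
    rw [laxYKow, laxY, shear]
    congr 2
    abel
  rw [hN, hN]

/-! ### Involutivity -/

open scoped Matrix.Norms.Operator in
theorem bracket_laxYKow_eq_zero {p q : ℕ} (hqp : q ≤ p) (F : Matrix (Fin p) (Fin q) ℝ) (c : ℂ)
    {lam mu : ℂ} (hlam : lam ∈ domY F c) (hmu : mu ∈ domY F c) (x : CotSO p)
    {φ ψ : Matrix (Blk p q) (Blk p q) ℂ → ℂ} (hφ : ContDiff ℂ 1 φ) (hψ : ContDiff ℂ 1 ψ)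
    (hφc : ∀ (U : (Matrix (Blk p q) (Blk p q) ℂ)ˣ) (M : Matrix (Blk p q) (Blk p q) ℂ),
      φ (U * M * (U⁻¹ : (Matrix (Blk p q) (Blk p q) ℂ)ˣ)) = φ M)
    (hψc : ∀ (U : (Matrix (Blk p q) (Blk p q) ℂ)ˣ) (M : Matrix (Blk p q) (Blk p q) ℂ),
      ψ (U * M * (U⁻¹ : (Matrix (Blk p q) (Blk p q) ℂ)ˣ)) = ψ M) :
    bracket (fun z => φ (laxYKow F c z lam)) (fun z => ψ (laxYKow F c z mu)) x = 0 := by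
  have hinv : ContinuousAt (fun nu : ℂ => nu⁻¹) mu := continuousAt_inv₀ hmu.1
  have hH : ContinuousAt (fun nu : ℂ => 1 - nu⁻¹ • yMat F c) mu := by fun_prop
  have hG : ContinuousAt (fun nu : ℂ => (1 - nu⁻¹ • yMat F c)⁻¹) mu := by
    obtain ⟨u, hu⟩ := hmu.2
    simp only [Matrix.nonsing_inv_eq_ringInverse]
    have h := NormedRing.inverse_continuousAt u
    rw [hu] at h
    exact ContinuousAt.comp (f := fun nu : ℂ => 1 - nu⁻¹ • yMat F c) h hH
  refine bracket_eq_zero_of_eventually (D := domY F c)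
    (fun nu _ => hasVelocity_laxYKow q x F c nu) hlam hmu ?_ ?_ (fun X => ?_) (fun X => ?_) hφ hψ
    fun nu hnu hne => ?_
  -- Nearby parameters stay admissible: being nonzero and invertibility are open conditions.
  · exact (continuousAt_id.eventually_ne hmu.1).and
      (hH.eventually (Units.isOpen.mem_nhds hmu.2))
  · unfold laxYKow laxY
    exact hG.mul (by fun_prop)
  · exact hG.mul continuousAt_const
  · unfold shear
    exact hG.mul (by fun_prop)
  · exact bracket_eq_zero_of_rMatrix (hasVelocity_laxYKow q x F c lam)
      (hasVelocity_laxYKow q x F c nu) (hφ.differentiable (by simp)) (hψ.differentiable (by simp))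
      hφc hψc (satisfiesRMatrix_laxYKow hqp F c lam hlam nu hnu hne x)

theorem spectralInvolution_laxYKow {p q : ℕ} (hqp : q ≤ p) (F : Matrix (Fin p) (Fin q) ℝ) (c : ℂ) :
    SpectralInvolution (laxYKow F c) (domY F c) := by
  intro lam hlam mu hmu x
  have htr : ∀ (i : ℕ) (U : (Matrix (Blk p q) (Blk p q) ℂ)ˣ) (M : Matrix (Blk p q) (Blk p q) ℂ),
      ((U * M * (U⁻¹ : (Matrix (Blk p q) (Blk p q) ℂ)ˣ)) ^ i).trace = (M ^ i).trace := by
    intro i U M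
    rw [Units.conj_pow, Matrix.trace_units_conj]
  have hch : ∀ (i : ℕ) (U : (Matrix (Blk p q) (Blk p q) ℂ)ˣ) (M : Matrix (Blk p q) (Blk p q) ℂ),
      (U * M * (U⁻¹ : (Matrix (Blk p q) (Blk p q) ℂ)ˣ)).charpoly.coeff i = M.charpoly.coeff i :=
    fun i U M => by rw [Matrix.coe_units_inv, Matrix.charpoly_units_conj]
  constructor
  · intro i j
    exact bracket_laxYKow_eq_zero hqp F c hlam hmu x (φ := fun M => (M ^ i).trace)
      (ψ := fun M => (M ^ j).trace) (contDiff_trace_pow i) (contDiff_trace_pow j) (htr i) (htr j)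
  · intro i j
    exact bracket_laxYKow_eq_zero hqp F c hlam hmu x (φ := fun M => M.charpoly.coeff i)
      (ψ := fun M => M.charpoly.coeff j) (contDiff_charpoly_coeff i) (contDiff_charpoly_coeff j)
      (hch i) (hch j)

/-! ### The undeformed case -/

theorem yMat_zero {p q : ℕ} (F : Matrix (Fin p) (Fin q) ℝ) : yMat F 0 = 0 := zero_smul _ _

theorem laxYKow_zero {p q : ℕ} (F : Matrix (Fin p) (Fin q) ℝ) : laxYKow F 0 = laxKow F := by
  funext x lam
  rw [← lax_kowPoint, laxYKow, laxY, lax, yMat_zero]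
  simp

theorem rKernelY_zero {p q : ℕ} (F : Matrix (Fin p) (Fin q) ℝ) : rKernelY F 0 = rKernel p q := by
  funext lam mu
  rw [rKernelY, yMat_zero]
  simp

theorem domY_zero {p q : ℕ} (F : Matrix (Fin p) (Fin q) ℝ) : domY F 0 = {lam | lam ≠ 0} := by
  simp [domY, yMat_zero]

end KowalevskiTop

end

theorem mainTheorem5 (p q : ℕ) (hqp : q ≤ p) (F : Matrix (Fin p) (Fin q) ℝ) (c : ℂ) :
    (KowalevskiTop.SpectralInvolution (KowalevskiTop.laxKow F) {lam : ℂ | lam ≠ 0} ∧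
      KowalevskiTop.SatisfiesRMatrix (KowalevskiTop.laxKow F) (KowalevskiTop.rKernel p q)
        {lam : ℂ | lam ≠ 0}) ∧
    (KowalevskiTop.SpectralInvolution (KowalevskiTop.laxYKow F c) (KowalevskiTop.domY F c) ∧
      KowalevskiTop.SatisfiesRMatrix (KowalevskiTop.laxYKow F c) (KowalevskiTop.rKernelY F c)
        (KowalevskiTop.domY F c)) := by
  refine ⟨?_, KowalevskiTop.spectralInvolution_laxYKow hqp F c,
    KowalevskiTop.satisfiesRMatrix_laxYKow hqp F c⟩
  -- At `c = 0` one has `y = 0`, so every dressing factor is the identity and only `λ ≠ 0` remains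
  -- of the domain condition.
  rw [← KowalevskiTop.laxYKow_zero, ← KowalevskiTop.rKernelY_zero F, ← KowalevskiTop.domY_zero F]
  exact ⟨KowalevskiTop.spectralInvolution_laxYKow hqp F 0,
    KowalevskiTop.satisfiesRMatrix_laxYKow hqp F 0⟩
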